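/- Let $p$ be a prime, let $P(t)\in\mathbb{Z}_p[t]$ be a monic polynomial whose image $\bar P(t)\in\mathbb{F}_p[t]$ modulo $p$ is irreducible, and let $G$ be a finite module over $\mathbb{Z}_p[t]/(P(t))$. Fix an integer $n\ge 1$. For a commutative ring $R$, a polynomial $Q\in R[t]$ and a matrix $A\in\mathrm{Mat}_n(R)$, regard $\mathrm{cok}(Q(A))=R^n/Q(A)R^n$ as an $R[t]/(Q(t))$-module through $t\cdot[v]=[Av]$. Let $r=\dim_{\mathbb{F}_p[t]/(\bar P(t))}(G/pG)$. Let $\bar X\in\mathrm{Mat}_n(\mathbb{F}_p)$ be any matrix such that $\mathrm{cok}(\bar P(\bar X))\simeq G/pG$ (as abelian groups, or equivalently as $\mathbb{F}_p[t]/(\bar P(t))$-modules). If $X$ is distributed according to the Haar probability measure on $\mathrm{Mat}_n(\mathbb{Z}_p)$, then the event below is measurable and \[ \mathrm{Prob}\Big(\mathrm{cok}(P(X))\simeq G \text{ as } \mathbb{Z}_p[t]/(P(t))\text{-modules, and } X\equiv\bar X \pmod p\Big) =\frac{p^{\deg(P)\,r^2-n^2}}{\big|\mathrm{Aut}_{\mathbb{Z}_p[t]/(P(t))}(G)\big|}\prod_{i=1}^{r}\big(1-p^{-i\deg(P)}\big)^2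 . \] -/

import Mathlib

open Polynomial MeasureTheory

noncomputable section

/-! ### The cokernel of `P(X)` as a module over `R[t]/(P(t))` -/

section Cokernel

variable {R : Type*} [CommRing R] {n : ℕ} (P : R[X]) (X : Matrix (Fin n) (Fin n) R)

/-- `cok(P(X)) = Rⁿ / P(X) Rⁿ`. -/
def PolyCok : Type _ :=
  (Fin n → R) ⧸ LinearMap.range (Matrix.mulVecLin (aeval X P))

instance PolyCok.instAddCommGroup : AddCommGroup (PolyCok P X) :=
  inferInstanceAs (AddCommGroup ((Fin n → R) ⧸ LinearMap.range (Matrix.mulVecLin (aeval X P))))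

/-- The `R`-module structure on the quotient `Rⁿ / P(X) Rⁿ`. -/
instance PolyCok.instModuleBase : Module R (PolyCok P X) :=
  inferInstanceAs (Module R ((Fin n → R) ⧸ LinearMap.range (Matrix.mulVecLin (aeval X P))))

/-- The quotient map `v ↦ [v]` from `Rⁿ` to `cok(P(X))`. -/
def PolyCok.mk : (Fin n → R) →ₗ[R] PolyCok P X :=
  Submodule.mkQ (LinearMap.range (Matrix.mulVecLin (aeval X P)))

theorem PolyCok.mk_surjective : Function.Surjective (PolyCok.mk P X) :=
  Submodule.mkQ_surjective _

/-- The endomorphism `[v] ↦ [X v]` of `cok(P(X))`. -/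
def PolyCok.tAct : Module.End R (PolyCok P X) :=
  Submodule.mapQ (LinearMap.range (Matrix.mulVecLin (aeval X P)))
    (LinearMap.range (Matrix.mulVecLin (aeval X P))) (Matrix.mulVecLin X) (by
      rintro _ ⟨w, rfl⟩
      refine ⟨X.mulVec w, ?_⟩
      have h : Commute (aeval X P) X := by
        have := Polynomial.aeval_X (R := R) X
        conv_rhs => rw [← this]
        exact Commute.map (Polynomial.commute_X P).symm (aeval X)
      simp only [Matrix.mulVecLin_apply, Matrix.mulVec_mulVec, h.eq])

theorem PolyCok.tAct_mk (v : Fin n → R) :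
    PolyCok.tAct P X (PolyCok.mk P X v) = PolyCok.mk P X (X.mulVec v) := rfl

theorem PolyCok.aeval_tAct_mk (Q : R[X]) (v : Fin n → R) :
    aeval (PolyCok.tAct P X) Q (PolyCok.mk P X v) = PolyCok.mk P X ((aeval X Q).mulVec v) := by
  induction Q using Polynomial.induction_on generalizing v with
  | C a => simp [Algebra.algebraMap_eq_smul_one, Matrix.smul_mulVec]
  | add f g hf hg => simp [hf, hg, Matrix.add_mulVec]
  | monomial k a h =>
    have e : (C a * Polynomial.X ^ (k + 1) : R[X]) =
        C a * Polynomial.X ^ k * Polynomial.X := by ring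
    rw [e, map_mul (aeval (PolyCok.tAct P X)), map_mul (aeval X) _ Polynomial.X, aeval_X, aeval_X,
      Module.End.mul_apply, PolyCok.tAct_mk, h, Matrix.mulVec_mulVec]

theorem PolyCok.aeval_tAct_self : aeval (PolyCok.tAct P X) P = 0 := by
  ext x
  obtain ⟨v, rfl⟩ := PolyCok.mk_surjective P X x
  rw [PolyCok.aeval_tAct_mk]
  exact (Submodule.Quotient.mk_eq_zero _).2 ⟨v, rfl⟩

/-- The action of `R[t]/(P(t))` on `cok(P(X))`, with `t` acting as `[v] ↦ [X v]`. -/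
def PolyCok.action : AdjoinRoot P →+* Module.End R (PolyCok P X) :=
  Ideal.Quotient.lift (Ideal.span {P}) (aeval (PolyCok.tAct P X)).toRingHom (by
    intro a ha
    obtain ⟨b, rfl⟩ := Ideal.mem_span_singleton.1 ha
    simp [PolyCok.aeval_tAct_self])

/-- `cok(P(X))` as a module over `R[t]/(P(t))`, with `t • [v] = [X v]`. -/
instance PolyCok.instModule : Module (AdjoinRoot P) (PolyCok P X) :=
  Module.compHom (PolyCok P X) (PolyCok.action P X)

theorem PolyCok.mk_smul_mk (Q : R[X]) (v : Fin n → R) :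
    AdjoinRoot.mk P Q • PolyCok.mk P X v = PolyCok.mk P X ((aeval X Q).mulVec v) :=
  PolyCok.aeval_tAct_mk P X Q v

theorem PolyCok.root_smul_mk (v : Fin n → R) :
    AdjoinRoot.root P • PolyCok.mk P X v = PolyCok.mk P X (X.mulVec v) := by
  rw [← AdjoinRoot.mk_X, PolyCok.mk_smul_mk, aeval_X]

end Cokernel

/-! ### Reduction modulo `p` -/

section Reduction

variable {p : ℕ} [Fact p.Prime] (P : ℤ_[p][X])

/-- The image of `P` in `𝔽_p[t]`. -/
abbrev redPoly : (ZMod p)[X] := P.map PadicInt.toZMod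

/-- The reduction map `ℤ_p[t]/(P(t)) → 𝔽_p[t]/(P(t))`. -/
def redHom : AdjoinRoot P →+* AdjoinRoot (redPoly P) :=
  AdjoinRoot.map PadicInt.toZMod P (redPoly P) dvd_rfl

theorem redHom_mk (Q : ℤ_[p][X]) :
    redHom P (AdjoinRoot.mk P Q) = AdjoinRoot.mk (redPoly P) (redPoly Q) := by
  simp only [redHom, AdjoinRoot.map, AdjoinRoot.lift_mk]
  rw [← Polynomial.eval₂_map, ← AdjoinRoot.algebraMap_eq]
  exact AdjoinRoot.aeval_eq _

theorem redHom_surjective : Function.Surjective (redHom P) := by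
  intro y
  obtain ⟨g, rfl⟩ := AdjoinRoot.mk_surjective y
  obtain ⟨Q, rfl⟩ := Polynomial.map_surjective PadicInt.toZMod
    (ZMod.ringHom_surjective PadicInt.toZMod) g
  exact ⟨AdjoinRoot.mk P Q, redHom_mk P Q⟩

theorem ker_redHom : RingHom.ker (redHom P) = Ideal.span {(p : AdjoinRoot P)} := by
  apply le_antisymm
  · intro x hx
    obtain ⟨Q, rfl⟩ := AdjoinRoot.mk_surjective x
    rw [RingHom.mem_ker, redHom_mk, AdjoinRoot.mk_eq_zero] at hx
    obtain ⟨g, hg⟩ := hx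
    obtain ⟨H, rfl⟩ := Polynomial.map_surjective PadicInt.toZMod
      (ZMod.ringHom_surjective PadicInt.toZMod) g
    have h : Q - P * H ∈ RingHom.ker (Polynomial.mapRingHom (PadicInt.toZMod (p := p))) := by
      rw [RingHom.mem_ker, Polynomial.coe_mapRingHom, Polynomial.map_sub, Polynomial.map_mul]
      exact sub_eq_zero.2 hg
    rw [Polynomial.ker_mapRingHom, PadicInt.ker_toZMod, PadicInt.maximalIdeal_eq_span_p,
      Ideal.map_span, Set.image_singleton, Ideal.mem_span_singleton] at h
    obtain ⟨K, hK⟩ := h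
    refine Ideal.mem_span_singleton.2 ⟨AdjoinRoot.mk P K, ?_⟩
    have := congrArg (AdjoinRoot.mk P) hK
    simpa using this
  · rw [Ideal.span_singleton_le_iff_mem, RingHom.mem_ker, map_natCast]
    have h : AdjoinRoot.of (redPoly P) (p : ZMod p) = 0 := by
      rw [CharP.cast_eq_zero, map_zero]
    rwa [map_natCast] at h

/-- The isomorphism `R/pR ≃ 𝔽_p[t]/(P(t))` for `R = ℤ_p[t]/(P(t))`, induced by reduction. -/
def redEquiv :
    (AdjoinRoot P ⧸ Ideal.span {(p : AdjoinRoot P)}) ≃+* AdjoinRoot (redPoly P) :=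
  (Ideal.quotEquivOfEq (ker_redHom P).symm).trans
    (RingHom.quotientKerEquivOfSurjective (redHom_surjective P))

variable (G : Type*) [AddCommGroup G] [Module (AdjoinRoot P) G]

/-- `G/pG` for a module `G` over `ℤ_p[t]/(P(t))`. -/
def RedMod : Type _ :=
  G ⧸ (Ideal.span {(p : AdjoinRoot P)} • (⊤ : Submodule (AdjoinRoot P) G))

instance RedMod.instAddCommGroup : AddCommGroup (RedMod P G) :=
  inferInstanceAs (AddCommGroup
    (G ⧸ (Ideal.span {(p : AdjoinRoot P)} • (⊤ : Submodule (AdjoinRoot P) G))))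

/-- The `R/pR`-module structure on `G/pG`, where `R = ℤ_p[t]/(P(t))`. -/
instance RedMod.instModuleQuot :
    Module (AdjoinRoot P ⧸ Ideal.span {(p : AdjoinRoot P)}) (RedMod P G) :=
  inferInstanceAs (Module (AdjoinRoot P ⧸ Ideal.span {(p : AdjoinRoot P)})
    (G ⧸ (Ideal.span {(p : AdjoinRoot P)} • (⊤ : Submodule (AdjoinRoot P) G))))

/-- `G/pG` as a module over `𝔽_p[t]/(P(t))`. -/
instance RedMod.instModule : Module (AdjoinRoot (redPoly P)) (RedMod P G) :=
  Module.compHom (RedMod P G) (redEquiv P).symm.toRingHom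

/-- The quotient map `G → G/pG`. -/
def RedMod.mk : G →+ RedMod P G :=
  (Submodule.mkQ (Ideal.span {(p : AdjoinRoot P)} •
    (⊤ : Submodule (AdjoinRoot P) G))).toAddMonoidHom

theorem RedMod.redHom_smul_mk (a : AdjoinRoot P) (g : G) :
    redHom P a • RedMod.mk P G g = RedMod.mk P G (a • g) := by
  have h : (redEquiv P).symm (redHom P a) = Ideal.Quotient.mk _ a := by
    rw [RingEquiv.symm_apply_eq]; rfl
  change (redEquiv P).symm (redHom P a) • RedMod.mk P G g = _
  rw [h]; rfl

/-- The dimension of `G/pG` over `𝔽_p[t]/(P(t))`. -/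
def resRank : ℕ := Module.finrank (AdjoinRoot (redPoly P)) (RedMod P G)

end Reduction

/-! ### Haar measure on `Mat_n(ℤ_p)` -/

section Haar

variable (p : ℕ) [Fact p.Prime] (n : ℕ)

/-- The Borel σ-algebra of the product topology on `Mat_n(ℤ_p)`. -/
instance instMeasurableSpacePadicMatrix :
    MeasurableSpace (Matrix (Fin n) (Fin n) ℤ_[p]) := borel _

instance instBorelSpacePadicMatrix : BorelSpace (Matrix (Fin n) (Fin n) ℤ_[p]) := ⟨rfl⟩

instance instCompactSpacePadicMatrix : CompactSpace (Matrix (Fin n) (Fin n) ℤ_[p]) :=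
  inferInstanceAs (CompactSpace (Fin n → Fin n → ℤ_[p]))

/-- The Haar probability measure on the compact additive group `Mat_n(ℤ_p)`: the Haar measure
that gives the whole group measure `1`. -/
def matHaar : Measure (Matrix (Fin n) (Fin n) ℤ_[p]) := Measure.addHaarMeasure ⊤

instance instIsAddHaarMatHaar : (matHaar p n).IsAddHaarMeasure :=
  inferInstanceAs (Measure.addHaarMeasure ⊤).IsAddHaarMeasure

instance instIsProbabilityMatHaar : IsProbabilityMeasure (matHaar p n) :=
  ⟨by simpa [matHaar] using
    Measure.addHaarMeasure_self (G := Matrix (Fin n) (Fin n) ℤ_[p]) (K₀ := ⊤)⟩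

end Haar

end

/-! Write R = ℤ_p[t]/(P), κ = R/pR = 𝔽_q with q = p^deg P, and N = |GL_r(κ)|. Since t acts on
cok(P(X)) as X, this cokernel is Rⁿ/(X - t)Rⁿ (`PolyCok.equivQuotSubRoot`), so a problem about a
polynomial in X becomes linear in X. An isomorphism of it with G is the same as a tuple g ∈ Gⁿ that
generates G with relation module (X - t)Rⁿ. Each X in the event has |Aut G| such tuples, so |Aut G|
times the probability is the sum over g of the measure of {X ≡ X̄ : g presents G with relations X -
t} (`sum_matHaar_real_isPresentation`).

Only tuples whose reduction presents G/pG with relations X̄ - t contribute. There are N |G|ⁿ/|G/pG|ⁿ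
of them, N being the number of isomorphisms cok(X̄ - t) ≃ G/pG (`natCard_lift_presentation`).

Fix such a g and write X = X₁ + pE. By Nakayama, g generates G even over ℤ_p, so E ↦ h = gE maps
onto Gⁿ and h is uniform there (`matHaar_real_add_smul`). Whether g presents G depends on h alone
(`isPresentation_add_smul_iff`): the relation g(X₁ - t) + ph = 0 must hold, which confines h to a
coset of G[p]ⁿ, and the connecting map ker(X̄ - t) → G[p] of the snake lemma must be onto. Moving h
within the coset by f ∈ Hom(κⁿ, G[p]) adds f restricted to ker(X̄ - t). Both spaces have dimension
r, so the connecting map is onto for a proportion N/q^(r²) of the coset (`natCard_perturbation`).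

As |G[p]| = |G/pG|, the product of the two counts is N² q^(-r²) p^(-n²), and N = q^(r²) ∏ (1 -
q^(-i)) gives the formula. -/

noncomputable section

/-! ### Counting over finite groups and finite fields -/

section Counting

/-- The fibres of a surjective homomorphism of finite groups all have the same size. -/
theorem AddMonoidHom.natCard_preimage_mul {A B : Type*} [AddCommGroup A] [AddCommGroup B]
    [Finite A] (f : A →+ B) (hf : Function.Surjective f) (S : Set B) :
    Nat.card {a // f a ∈ S} * Nat.card B = Nat.card S * Nat.card A := by
  have key : ∀ T : Set B, Nat.card {a // f a ∈ T} = Nat.card T * Nat.card f.ker := by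
    intro T
    rw [← Nat.card_prod]
    refine Nat.card_congr
      { toFun := fun a => (⟨f a, a.2⟩, ⟨a.1 - Function.surjInv hf (f a), by
          rw [AddMonoidHom.mem_ker, map_sub, Function.surjInv_eq hf, sub_self]⟩)
        invFun := fun b => ⟨b.2.1 + Function.surjInv hf b.1.1, by
          rw [map_add, b.2.2, zero_add, Function.surjInv_eq hf]; exact b.1.2⟩
        left_inv := fun a => by simp
        right_inv := fun b => ?_ }
    have hb : f (b.2.1 + Function.surjInv hf b.1.1) = b.1.1 := by
      rw [map_add, b.2.2, zero_add, Function.surjInv_eq hf]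
    refine Prod.ext (Subtype.ext hb) (Subtype.ext ?_)
    simp [hb]
  -- The case T = B gives |A| = |B| |ker f|, which eliminates the kernel.
  have h1 := key Set.univ
  have h2 : Nat.card {a // f a ∈ (Set.univ : Set B)} = Nat.card A :=
    Nat.card_congr (Equiv.subtypeUnivEquiv fun _ => Set.mem_univ _)
  rw [h2, Nat.card_congr (Equiv.Set.univ B)] at h1
  rw [key S, h1]
  ring

/-- The tuples generating `M` with relation module `N` correspond to the isomorphisms
`Rⁿ / N ≃ M`. -/
theorem natCard_linearCombination {R M : Type*} [CommRing R] [AddCommGroup M] [Module R M]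
    {n : ℕ} (N : Submodule R (Fin n → R)) :
    Nat.card {g : Fin n → M // Function.Surjective (Fintype.linearCombination R g) ∧
      LinearMap.ker (Fintype.linearCombination R g) = N} =
    Nat.card (((Fin n → R) ⧸ N) ≃ₗ[R] M) := by
  have hcomp : ∀ e : ((Fin n → R) ⧸ N) ≃ₗ[R] M,
      Fintype.linearCombination R (fun i => e (N.mkQ (Pi.single i 1))) =
        e.toLinearMap ∘ₗ N.mkQ := by
    intro e
    refine LinearMap.pi_ext' fun i => LinearMap.ext_ring ?_
    simp [Fintype.linearCombination_apply_single]
  refine Nat.card_congr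
    { toFun := fun g => (Submodule.quotEquivOfEq _ _ g.2.2.symm).trans
        (LinearMap.quotKerEquivOfSurjective _ g.2.1)
      invFun := fun e => ⟨fun i => e (N.mkQ (Pi.single i 1)), ?_, ?_⟩
      left_inv := fun g => ?_
      right_inv := fun e => ?_ }
  · rw [hcomp]
    exact e.surjective.comp N.mkQ_surjective
  · rw [hcomp, LinearEquiv.ker_comp, Submodule.ker_mkQ]
  · refine Subtype.ext (funext fun i => ?_)
    change Fintype.linearCombination R g.1 (Pi.single i 1) = _
    rw [Fintype.linearCombination_apply_single, one_smul]
  · refine LinearEquiv.ext fun x => ?_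
    obtain ⟨v, rfl⟩ := N.mkQ_surjective x
    change Fintype.linearCombination R (fun i => e (N.mkQ (Pi.single i 1))) v = _
    rw [hcomp]
    rfl

theorem natCard_linearEquiv_eq {R M N : Type*} [CommRing R] [AddCommGroup M] [Module R M]
    [AddCommGroup N] [Module R N] (e : M ≃ₗ[R] N) :
    Nat.card (M ≃ₗ[R] N) = Nat.card (N ≃ₗ[R] N) :=
  Nat.card_congr
    { toFun := fun f => e.symm.trans f
      invFun := fun f => e.trans f
      left_inv := fun f => by ext; simp
      right_inv := fun f => by ext; simp }

variable {k V W U : Type*} [Field k] [AddCommGroup V] [Module k V] [AddCommGroup W]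
  [Module k W] [AddCommGroup U] [Module k U]

theorem natCard_linearEquiv_of_finrank_eq [Finite k] [Finite V] [Finite W] {r : ℕ}
    (hV : Module.finrank k V = r) (hW : Module.finrank k W = r) :
    Nat.card (V ≃ₗ[k] W) = ∏ i : Fin r, (Nat.card k ^ r - Nat.card k ^ (i : ℕ)) := by
  have := Fintype.ofFinite k
  have e := LinearEquiv.ofFinrankEq V W (hV.trans hW.symm)
  let b := Module.finBasisOfFinrankEq k W hW
  rw [natCard_linearEquiv_eq e, Nat.card_eq_fintype_card (α := k), ← Matrix.card_GL_field]
  exact Nat.card_congr ((LinearMap.GeneralLinearGroup.generalLinearEquiv k W).symm.toEquiv.trans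
    (Units.mapEquiv (LinearMap.toMatrixAlgEquiv b).toMulEquiv).toEquiv)

theorem natCard_surjective_of_finrank_eq [Finite k] [Finite V] [Finite W] {r : ℕ}
    (hV : Module.finrank k V = r) (hW : Module.finrank k W = r) :
    Nat.card {f : V →ₗ[k] W // Function.Surjective f} =
      ∏ i : Fin r, (Nat.card k ^ r - Nat.card k ^ (i : ℕ)) := by
  rw [← natCard_linearEquiv_of_finrank_eq hV hW]
  have hinj : ∀ f : V →ₗ[k] W, Function.Surjective f → Function.Injective f := fun f hf =>
    (LinearMap.injective_iff_surjective_of_finrank_eq_finrank (hV.trans hW.symm)).2 hf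
  exact Nat.card_congr
    { toFun := fun f => LinearEquiv.ofBijective f.1 ⟨hinj f.1 f.2, f.2⟩
      invFun := fun e => ⟨e.toLinearMap, e.surjective⟩
      left_inv := fun _ => rfl
      right_inv := fun _ => LinearEquiv.ext fun _ => rfl }

theorem natCard_linearMap_of_finrank_eq [Finite V] [Finite W] {r : ℕ}
    (hV : Module.finrank k V = r) (hW : Module.finrank k W = r) :
    Nat.card (V →ₗ[k] W) = Nat.card k ^ r ^ 2 := by
  rw [Module.natCard_eq_pow_finrank (K := k), Module.finrank_linearMap, hV, hW, sq]

/-- The number of `f : U → W` for which `φ + f|_V` is onto, if `V` and `W` have the same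
dimension. -/
theorem natCard_surjective_add_restrict [Finite k] [Finite U] [Finite W] (V : Submodule k U)
    {r : ℕ}
    (hV : Module.finrank k V = r) (hW : Module.finrank k W = r) (φ : V →ₗ[k] W) :
    Nat.card {f : U →ₗ[k] W // Function.Surjective (φ + f ∘ₗ V.subtype)} *
      Nat.card k ^ r ^ 2 =
    (∏ i : Fin r, (Nat.card k ^ r - Nat.card k ^ (i : ℕ))) * Nat.card (U →ₗ[k] W) := by
  have : Finite (U →ₗ[k] W) := DFunLike.finite _
  let res : (U →ₗ[k] W) →+ (V →ₗ[k] W) :=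
    { toFun := fun f => f ∘ₗ V.subtype
      map_zero' := LinearMap.zero_comp _
      map_add' := fun f g => LinearMap.add_comp _ _ _ }
  -- Restriction to a subspace is onto, so all its fibres have the same size; translation by `φ`
  -- then reduces to counting surjections V → W.
  have hres : Function.Surjective res := fun f => LinearMap.exists_extend f
  have h := res.natCard_preimage_mul hres {f | Function.Surjective (φ + f)}
  rw [natCard_linearMap_of_finrank_eq hV hW] at h
  rw [← natCard_surjective_of_finrank_eq hV hW]
  refine h.trans (congrArg (· * _) (Nat.card_congr ((Equiv.addLeft φ).subtypeEquiv ?_)))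
  intro f
  rfl

end Counting

/-! ### Linearization: cok(Q(X)) as the cokernel of X - t -/

section Linearization

variable {S : Type*} [CommRing S] {n : ℕ}

/-- The endomorphism `X - t` of `Rⁿ`, where `R = S[t]/(Q(t))`. -/
def subRoot (Q : S[X]) (X : Matrix (Fin n) (Fin n) S) :
    (Fin n → AdjoinRoot Q) →ₗ[AdjoinRoot Q] (Fin n → AdjoinRoot Q) :=
  (X.map (AdjoinRoot.of Q)).mulVecLin - AdjoinRoot.root Q • LinearMap.id

theorem subRoot_apply (Q : S[X]) (X : Matrix (Fin n) (Fin n) S) (v : Fin n → AdjoinRoot Q) :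
    subRoot Q X v = (X.map (AdjoinRoot.of Q)).mulVec v - AdjoinRoot.root Q • v := rfl

theorem of_comp_mulVec (Q : S[X]) (X : Matrix (Fin n) (Fin n) S) (v : Fin n → S) :
    (fun i => AdjoinRoot.of Q (X.mulVec v i)) =
      (X.map (AdjoinRoot.of Q)).mulVec (fun i => AdjoinRoot.of Q (v i)) := by
  funext i
  exact RingHom.map_mulVec (AdjoinRoot.of Q) X v i

variable (Q : S[X]) (X : Matrix (Fin n) (Fin n) S)

theorem PolyCok.of_smul (a : S) (x : PolyCok Q X) : AdjoinRoot.of Q a • x = a • x := by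
  obtain ⟨v, rfl⟩ := PolyCok.mk_surjective Q X x
  rw [← AdjoinRoot.mk_C, PolyCok.mk_smul_mk, aeval_C, Algebra.algebraMap_eq_smul_one,
    Matrix.smul_mulVec, Matrix.one_mulVec, map_smul]

theorem PolyCok.linearCombination_of (v : Fin n → S) :
    Fintype.linearCombination (AdjoinRoot Q) (fun i => PolyCok.mk Q X (Pi.single i 1))
      (fun i => AdjoinRoot.of Q (v i)) = PolyCok.mk Q X v := by
  rw [Fintype.linearCombination_apply]
  simp only [PolyCok.of_smul, ← map_smul, ← map_sum]
  congr 1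
  funext j
  simp [Finset.sum_apply, Pi.single_apply]

theorem mkQ_subRoot_mulVec (v : Fin n → AdjoinRoot Q) :
    (LinearMap.range (subRoot Q X)).mkQ ((X.map (AdjoinRoot.of Q)).mulVec v) =
      AdjoinRoot.root Q • (LinearMap.range (subRoot Q X)).mkQ v := by
  rw [← map_smul, ← sub_eq_zero, ← map_sub, ← subRoot_apply, ← LinearMap.mem_ker,
    Submodule.ker_mkQ]
  exact ⟨v, rfl⟩

/-- Modulo the image of X - t, applying X is multiplication by t, hence applying T(X) is
multiplication by T(t). -/
theorem mkQ_subRoot_aeval_mulVec (T : S[X]) (v : Fin n → S) :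
    (LinearMap.range (subRoot Q X)).mkQ (fun i => AdjoinRoot.of Q ((aeval X T).mulVec v i)) =
      AdjoinRoot.mk Q T •
        (LinearMap.range (subRoot Q X)).mkQ (fun i => AdjoinRoot.of Q (v i)) := by
  induction T using Polynomial.induction_on generalizing v with
  | C a =>
    rw [aeval_C, Algebra.algebraMap_eq_smul_one, AdjoinRoot.mk_C, ← map_smul]
    congr 1
    funext i
    simp [Matrix.smul_mulVec]
  | add f g hf hg =>
    rw [map_add (AdjoinRoot.mk Q), add_smul, ← hf, ← hg, ← map_add (Submodule.mkQ _)]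
    refine congrArg _ (funext fun i => ?_)
    simp [Matrix.add_mulVec]
  | monomial m a h =>
    have e : (C a * Polynomial.X ^ (m + 1) : S[X]) =
        C a * Polynomial.X ^ m * Polynomial.X := by ring
    rw [e, map_mul (aeval X) _ Polynomial.X, aeval_X, ← Matrix.mulVec_mulVec, h,
      of_comp_mulVec, mkQ_subRoot_mulVec, smul_smul,
      map_mul (AdjoinRoot.mk Q) _ Polynomial.X, AdjoinRoot.mk_X]

/-- `Sⁿ / Q(X) Sⁿ` is the cokernel of `X - t` on `(S[t]/(Q(t)))ⁿ`. -/
def PolyCok.equivQuotSubRoot :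
    PolyCok Q X ≃ₗ[AdjoinRoot Q] ((Fin n → AdjoinRoot Q) ⧸ LinearMap.range (subRoot Q X)) := by
  let Θ := Fintype.linearCombination (AdjoinRoot Q) (fun i => PolyCok.mk Q X (Pi.single i 1))
  let ofS : (Fin n → S) →+ (Fin n → AdjoinRoot Q) :=
    { toFun := fun v i => AdjoinRoot.of Q (v i)
      map_zero' := by funext i; simp
      map_add' := fun v w => by funext i; simp }
  let ψ₀ : (Fin n → S) →+ ((Fin n → AdjoinRoot Q) ⧸ LinearMap.range (subRoot Q X)) :=
    (LinearMap.range (subRoot Q X)).mkQ.toAddMonoidHom.comp ofS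
  -- Q(X)w becomes Q(t)w, and Q(t) = 0 in S[t]/(Q).
  let ψ₁ : PolyCok Q X →+ ((Fin n → AdjoinRoot Q) ⧸ LinearMap.range (subRoot Q X)) :=
    QuotientAddGroup.lift _ ψ₀ (by
      rintro _ ⟨w, rfl⟩
      have := mkQ_subRoot_aeval_mulVec Q X Q w
      rw [AdjoinRoot.mk_self, zero_smul] at this
      exact this)
  have hψ₁ : ∀ v : Fin n → S, ψ₁ (PolyCok.mk Q X v) =
      (LinearMap.range (subRoot Q X)).mkQ (fun i => AdjoinRoot.of Q (v i)) := fun v => rfl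
  let ψ : PolyCok Q X →ₗ[AdjoinRoot Q]
      ((Fin n → AdjoinRoot Q) ⧸ LinearMap.range (subRoot Q X)) :=
    { ψ₁ with
      map_smul' := by
        intro a x
        obtain ⟨T, rfl⟩ := AdjoinRoot.mk_surjective a
        obtain ⟨v, rfl⟩ := PolyCok.mk_surjective Q X x
        change ψ₁ _ = _ • ψ₁ _
        rw [PolyCok.mk_smul_mk, hψ₁, hψ₁]
        exact mkQ_subRoot_aeval_mulVec Q X T v }
  have hle : LinearMap.range (subRoot Q X) ≤ LinearMap.ker Θ := by
    rw [LinearMap.range_le_ker_iff]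
    refine LinearMap.pi_ext' fun j => LinearMap.ext_ring ?_
    change Θ (subRoot Q X (Pi.single j 1)) = 0
    have h1 : (Pi.single j 1 : Fin n → AdjoinRoot Q) =
        fun i => AdjoinRoot.of Q ((Pi.single j 1 : Fin n → S) i) := by
      funext i
      by_cases h : i = j <;> simp [h]
    rw [subRoot_apply, h1, ← of_comp_mulVec, map_sub, map_smul, PolyCok.linearCombination_of,
      PolyCok.linearCombination_of, PolyCok.root_smul_mk, sub_self]
  refine LinearEquiv.ofLinearMap ψ ((LinearMap.range (subRoot Q X)).liftQ Θ hle) ?_ ?_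
  · refine Submodule.linearMap_qext _ (LinearMap.pi_ext' fun j => LinearMap.ext_ring ?_)
    change ψ (Θ (Pi.single j 1)) = (LinearMap.range (subRoot Q X)).mkQ (Pi.single j 1)
    rw [Fintype.linearCombination_apply_single, one_smul]
    refine (hψ₁ _).trans (congrArg _ (funext fun i => ?_))
    by_cases h : i = j <;> simp [h]
  · refine LinearMap.ext fun x => ?_
    obtain ⟨v, rfl⟩ := PolyCok.mk_surjective Q X x
    change (LinearMap.range (subRoot Q X)).liftQ Θ hle (ψ₁ (PolyCok.mk Q X v)) = PolyCok.mk Q X v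
    rw [hψ₁]
    exact PolyCok.linearCombination_of Q X v

end Linearization

/-! ### Presentations, reduction modulo π and the connecting map -/

section ModuleReduction

variable {R κ G D W : Type*} {n : ℕ} [CommRing R] [Field κ] [AddCommGroup G] [Module R G]
  [AddCommGroup D] [Module κ D] [AddCommGroup W] [Module κ W]

theorem linearCombination_comp_ringHom {ρ : R →+* κ} {mk : G →+ D}
    (hmk : ∀ a x, mk (a • x) = ρ a • mk x) (g : Fin n → G) (v : Fin n → R) :
    Fintype.linearCombination κ (mk ∘ g) (ρ ∘ v) = mk (Fintype.linearCombination R g v) := by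
  simp [Fintype.linearCombination_apply, hmk]

theorem map_linearCombination {ρ : R →+* κ} {ι : W →+ G}
    (hι : ∀ a w, ι (ρ a • w) = a • ι w) (h : Fin n → W) (v : Fin n → R) :
    ι (Fintype.linearCombination κ h (ρ ∘ v)) = Fintype.linearCombination R (ι ∘ h) v := by
  simp [Fintype.linearCombination_apply, hι]

theorem linearCombination_add_left (g h : Fin n → G) (v : Fin n → R) :
    Fintype.linearCombination R (g + h) v =
      Fintype.linearCombination R g v + Fintype.linearCombination R h v := by
  simp [Fintype.linearCombination_apply, Finset.sum_add_distrib]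

theorem linearCombination_smul_left (a : R) (h : Fin n → G) (v : Fin n → R) :
    Fintype.linearCombination R (a • h) v = a • Fintype.linearCombination R h v := by
  simp [Fintype.linearCombination_apply, Finset.smul_sum, smul_comm a]

theorem finrank_ker_eq_finrank_quotient_range (f : (Fin n → κ) →ₗ[κ] (Fin n → κ)) :
    Module.finrank κ (LinearMap.ker f) = Module.finrank κ ((Fin n → κ) ⧸ LinearMap.range f) := by
  have h1 := LinearMap.finrank_range_add_finrank_ker f
  have h2 := Submodule.finrank_quotient_add_finrank (LinearMap.range f)
  omega

theorem exists_smul_eq_of_comp_eq {ρ : R →+* κ} {π : R} (hπ : ∀ a, ρ a = 0 ↔ π ∣ a)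
    {v : Fin n → R} (hv : ρ ∘ v = 0) : ∃ w, v = π • w := by
  have h : ∀ i, π ∣ v i := fun i => (hπ _).1 (congrFun hv i)
  choose w hw using h
  exact ⟨w, funext hw⟩

theorem comp_smul_eq_zero {ρ : R →+* κ} {π : R} (hπ : ∀ a, ρ a = 0 ↔ π ∣ a)
    (w : Fin n → R) : ρ ∘ (π • w) = 0 :=
  funext fun i => (hπ _).2 ⟨w i, rfl⟩

theorem comp_sub_eq (ρ : R →+* κ) (v w : Fin n → R) : ρ ∘ (v - w) = ρ ∘ v - ρ ∘ w :=
  funext fun _ => map_sub ρ _ _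

theorem comp_add_eq (ρ : R →+* κ) (v w : Fin n → R) : ρ ∘ (v + w) = ρ ∘ v + ρ ∘ w :=
  funext fun _ => map_add ρ _ _

/-- The tuples in `G` whose reduction presents `G/πG` with relation module `range Ā`. -/
theorem natCard_lift_presentation [Finite κ] [Finite G] {mk : G →+ D}
    (hsurj : Function.Surjective mk) {r : ℕ} (Abar : (Fin n → κ) →ₗ[κ] (Fin n → κ))
    (hD : Module.finrank κ D = r)
    (hA : Module.finrank κ ((Fin n → κ) ⧸ LinearMap.range Abar) = r) :
    Nat.card {g : Fin n → G // Function.Surjective (Fintype.linearCombination κ (mk ∘ g)) ∧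
      LinearMap.ker (Fintype.linearCombination κ (mk ∘ g)) = LinearMap.range Abar} *
      Nat.card D ^ n =
    (∏ i : Fin r, (Nat.card κ ^ r - Nat.card κ ^ (i : ℕ))) * Nat.card G ^ n := by
  have : Finite D := Finite.of_surjective mk hsurj
  have : Finite ((Fin n → κ) ⧸ LinearMap.range Abar) :=
    Finite.of_surjective _ (Submodule.mkQ_surjective _)
  have h := (mk.compLeft (Fin n)).natCard_preimage_mul hsurj.comp_left
    {g | Function.Surjective (Fintype.linearCombination κ g) ∧
      LinearMap.ker (Fintype.linearCombination κ g) = LinearMap.range Abar}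
  rw [Nat.card_fun, Nat.card_fun, Nat.card_fin] at h
  rw [← natCard_linearEquiv_of_finrank_eq hA hD, ← natCard_linearCombination]
  exact h

variable {ρ : R →+* κ} {π : R}

/-- Right exactness of reduction modulo π. If a combination of g equals πy, lifting y through g
corrects its coefficient vector by a multiple of π to a true relation. -/
theorem surjective_and_ker_reduction (hρ : Function.Surjective ρ) {mk : G →+ D}
    (hmk : ∀ a x, mk (a • x) = ρ a • mk x) (hsurj : Function.Surjective mk)
    (hmk0 : ∀ x, mk x = 0 ↔ ∃ y, x = π • y) (hπ : ∀ a, ρ a = 0 ↔ π ∣ a)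
    {A : (Fin n → R) →ₗ[R] (Fin n → R)} {Abar : (Fin n → κ) →ₗ[κ] (Fin n → κ)}
    (hA : ∀ v, Abar (ρ ∘ v) = ρ ∘ A v) {g : Fin n → G}
    (hg : Function.Surjective (Fintype.linearCombination R g))
    (hker : LinearMap.ker (Fintype.linearCombination R g) = LinearMap.range A) :
    Function.Surjective (Fintype.linearCombination κ (mk ∘ g)) ∧
      LinearMap.ker (Fintype.linearCombination κ (mk ∘ g)) = LinearMap.range Abar := by
  refine ⟨fun d => ?_, le_antisymm ?_ ?_⟩
  · obtain ⟨x, rfl⟩ := hsurj d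
    obtain ⟨v, rfl⟩ := hg x
    exact ⟨_, linearCombination_comp_ringHom hmk g v⟩
  · intro u hu
    obtain ⟨v, rfl⟩ := hρ.comp_left u
    rw [LinearMap.mem_ker, linearCombination_comp_ringHom hmk, hmk0] at hu
    obtain ⟨y, hy⟩ := hu
    obtain ⟨w, rfl⟩ := hg y
    have h : v - π • w ∈ LinearMap.ker (Fintype.linearCombination R g) := by
      rw [LinearMap.mem_ker, map_sub, hy, map_smul, sub_self]
    rw [hker] at h
    obtain ⟨x, hx⟩ := h
    refine ⟨ρ ∘ x, ?_⟩
    rw [hA, hx, comp_sub_eq, comp_smul_eq_zero hπ, sub_zero]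
  · rintro _ ⟨u, rfl⟩
    obtain ⟨v, rfl⟩ := hρ.comp_left u
    have h : A v ∈ LinearMap.ker (Fintype.linearCombination R g) := hker ▸ ⟨v, rfl⟩
    rw [LinearMap.mem_ker, hA, linearCombination_comp_ringHom hmk, LinearMap.mem_ker.1 h, map_zero]

/-- If `g` presents `G` modulo `π` with relations `Ā`, then `g` presents `G` with relations `A`
iff the connecting map `v ↦ F(A v / π)` is onto `G[π]`. -/
theorem ker_eq_range_iff [IsNoetherianRing R] (hjac : π ∈ Ideal.jacobson (⊥ : Ideal R))
    (hρ : Function.Surjective ρ) (hπ : ∀ a, ρ a = 0 ↔ π ∣ a) {mk : G →+ D}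
    (hmk : ∀ a x, mk (a • x) = ρ a • mk x)
    {A : (Fin n → R) →ₗ[R] (Fin n → R)} {Abar : (Fin n → κ) →ₗ[κ] (Fin n → κ)}
    (hA : ∀ v, Abar (ρ ∘ v) = ρ ∘ A v) {g : Fin n → G}
    (hg : Function.Surjective (Fintype.linearCombination R g))
    (hker : LinearMap.ker (Fintype.linearCombination κ (mk ∘ g)) = LinearMap.range Abar)
    (hle : ∀ v, Fintype.linearCombination R g (A v) = 0) :
    LinearMap.ker (Fintype.linearCombination R g) = LinearMap.range A ↔
      ∀ y : G, π • y = 0 → ∃ v x, A v = π • x ∧ Fintype.linearCombination R g x = y := by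
  constructor
  · intro h y hy
    obtain ⟨x, rfl⟩ := hg y
    have hx : π • x ∈ LinearMap.ker (Fintype.linearCombination R g) := by
      rw [LinearMap.mem_ker, map_smul, hy]
    rw [h] at hx
    obtain ⟨v, hv⟩ := hx
    exact ⟨v, x, hv, rfl⟩
  · intro h
    refine le_antisymm ?_ (by rintro _ ⟨v, rfl⟩; exact hle v)
    -- Nakayama: it suffices that the kernel lies in range A + π · kernel.
    refine Submodule.le_of_le_smul_of_le_jacobson_bot (I := Ideal.span {π})
      (IsNoetherian.noetherian _) (by rwa [Ideal.span_singleton_le_iff_mem]) ?_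
    intro k hk
    rw [LinearMap.mem_ker] at hk
    have hk' : ρ ∘ k ∈ LinearMap.range Abar := by
      rw [← hker, LinearMap.mem_ker, linearCombination_comp_ringHom hmk, hk, map_zero]
    obtain ⟨u, hu⟩ := hk'
    obtain ⟨v, rfl⟩ := hρ.comp_left u
    rw [hA, eq_comm, ← sub_eq_zero, ← comp_sub_eq] at hu
    obtain ⟨x, hx⟩ := exists_smul_eq_of_comp_eq hπ hu
    -- Here k - A v = πx, and both k and A v map to 0, so x maps into G[π]. The hypothesis supplies
    -- x' with the same image and πx' = A v', so x - x' is in the kernel.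
    obtain ⟨v', x', hv', hx'⟩ := h (Fintype.linearCombination R g x) (by
      rw [← map_smul, ← hx, map_sub, hk, hle, sub_zero])
    have e : k = A (v + v') + π • (x - x') := by
      rw [map_add, hv', smul_sub, ← hx]
      abel
    rw [e]
    refine Submodule.add_mem_sup ⟨_, rfl⟩ ?_
    exact Submodule.smul_mem_smul (Ideal.mem_span_singleton_self π) (by
      rw [LinearMap.mem_ker, map_sub, hx', sub_self])

/-- The number of perturbations `h` of a given relation matrix `A` modulo `π²` that make the
connecting map onto. -/
theorem natCard_perturbation [Finite κ] [Finite G]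
    (hπ0 : ∀ a, π * a = 0 → a = 0)
    (hρ : Function.Surjective ρ) (hπ : ∀ a, ρ a = 0 ↔ π ∣ a) {ι : W →+ G}
    (hι : ∀ a w, ι (ρ a • w) = a • ι w) (hinj : Function.Injective ι)
    (hrange : ∀ x, π • x = 0 ↔ ∃ w, ι w = x)
    {A : (Fin n → R) →ₗ[R] (Fin n → R)} {Abar : (Fin n → κ) →ₗ[κ] (Fin n → κ)}
    (hA : ∀ v, Abar (ρ ∘ v) = ρ ∘ A v) {r : ℕ} (hW : Module.finrank κ W = r)
    (hAr : Module.finrank κ ((Fin n → κ) ⧸ LinearMap.range Abar) = r) {g : Fin n → G}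
    {c : Fin n → G} (hc : ∀ v, Fintype.linearCombination R g (A v) =
      Fintype.linearCombination R c v) {h₀ : Fin n → G} (hh₀ : c + π • h₀ = 0) :
    Nat.card {h : Fin n → G // c + π • h = 0 ∧ ∀ y : G, π • y = 0 → ∃ v x, A v = π • x ∧
      Fintype.linearCombination R g x + Fintype.linearCombination R h v = y} *
      Nat.card κ ^ r ^ 2 =
    (∏ i : Fin r, (Nat.card κ ^ r - Nat.card κ ^ (i : ℕ))) * Nat.card W ^ n := by
  have : Finite W := Finite.of_injective ι hinj
  have hcan : ∀ x y : Fin n → R, π • x = π • y → x = y := fun x y hxy =>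
    funext fun i => sub_eq_zero.1 (hπ0 _ (by
      have := congrFun hxy i
      simp only [Pi.smul_apply, smul_eq_mul] at this
      rw [mul_sub, this, sub_self]))
  have hlc : ∀ v, Fintype.linearCombination R g (A v) +
      π • Fintype.linearCombination R h₀ v = 0 := fun v => by
    rw [hc, ← linearCombination_smul_left, ← linearCombination_add_left, hh₀]
    simp [Fintype.linearCombination_apply]
  have hlift : ∀ u : LinearMap.ker Abar, ∃ v x, ρ ∘ v = u.1 ∧ A v = π • x := by
    rintro ⟨u, hu⟩
    obtain ⟨v, rfl⟩ := hρ.comp_left u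
    rw [LinearMap.mem_ker, hA] at hu
    obtain ⟨x, hx⟩ := exists_smul_eq_of_comp_eq hπ hu
    exact ⟨v, x, rfl, hx⟩
  -- The connecting map at the base point `h₀`. Two lifts of u differ by some πd, which changes x =
  -- A v / π by A d; the total change is g(A d) + π h₀(d) = 0, so the value is well defined.
  have hdef : ∀ u : LinearMap.ker Abar, ∃ w : W, ∀ v x, ρ ∘ v = u.1 → A v = π • x →
      ι w = Fintype.linearCombination R g x + Fintype.linearCombination R h₀ v := by
    intro u
    obtain ⟨v, x, hv, hx⟩ := hlift u
    obtain ⟨w, hw⟩ := (hrange (Fintype.linearCombination R g x +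
      Fintype.linearCombination R h₀ v)).1 (by
        rw [smul_add, ← map_smul, ← hx]; exact hlc v)
    refine ⟨w, fun v' x' hv' hx' => hw.trans ?_⟩
    obtain ⟨d, hd⟩ := exists_smul_eq_of_comp_eq hπ (v := v - v') (by
      rw [comp_sub_eq, hv, hv', sub_self])
    have hxd : x - x' = A d := hcan _ _ (by
      rw [smul_sub, ← hx, ← hx', ← map_sub, hd, map_smul])
    rw [eq_comm, ← sub_eq_zero, ← neg_eq_zero, neg_sub, add_sub_add_comm, ← map_sub, ← map_sub,
      hxd, hd, map_smul]
    exact hlc d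
  choose φ hφ using hdef
  let Φ : LinearMap.ker Abar →ₗ[κ] W :=
    { toFun := φ
      map_add' := by
        intro u₁ u₂
        obtain ⟨v₁, x₁, hv₁, hx₁⟩ := hlift u₁
        obtain ⟨v₂, x₂, hv₂, hx₂⟩ := hlift u₂
        apply hinj
        rw [map_add, hφ u₁ v₁ x₁ hv₁ hx₁, hφ u₂ v₂ x₂ hv₂ hx₂,
          hφ (u₁ + u₂) (v₁ + v₂) (x₁ + x₂) (by rw [comp_add_eq, hv₁, hv₂]; rfl)
            (by rw [map_add, hx₁, hx₂, smul_add]), map_add, map_add]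
        abel
      map_smul' := by
        intro b u
        obtain ⟨a, rfl⟩ := hρ b
        obtain ⟨v, x, hv, hx⟩ := hlift u
        apply hinj
        rw [RingHom.id_apply, hι, hφ u v x hv hx, hφ (ρ a • u) (a • v) (a • x) (by
          rw [Submodule.coe_smul, ← hv]; exact funext fun i => map_mul ρ _ _)
          (by rw [map_smul, hx, smul_comm]), map_smul, map_smul, smul_add] }
  have hmain := natCard_surjective_add_restrict (LinearMap.ker Abar)
    ((finrank_ker_eq_finrank_quotient_range Abar).trans hAr) hW Φ
  have hhom : Nat.card ((Fin n → κ) →ₗ[κ] W) = Nat.card W ^ n := by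
    rw [← Nat.card_congr ((Pi.basisFun κ (Fin n)).constr κ).toEquiv, Nat.card_fun, Nat.card_fin]
  rw [hhom] at hmain
  rw [← hmain]
  have hf : ∀ (f : (Fin n → κ) →ₗ[κ] W) v, ι (f (ρ ∘ v)) =
      Fintype.linearCombination R (ι ∘ fun i => f (Pi.single i 1)) v := by
    intro f v
    rw [← map_linearCombination hι]
    congr 1
    conv_lhs => rw [LinearMap.pi_apply_eq_sum_univ f]
    rw [Fintype.linearCombination_apply]
    refine Finset.sum_congr rfl fun i _ => ?_
    congr 2
    funext j
    simp [Pi.single_apply, eq_comm]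
  -- Replacing `h₀` by `h₀ + ι ∘ f` adds to the connecting map exactly the restriction of f to ker
  -- Ā.
  have hΦ : ∀ (f : (Fin n → κ) →ₗ[κ] W) (v x) (hv : ρ ∘ v ∈ LinearMap.ker Abar),
      A v = π • x → ι ((Φ + f ∘ₗ (LinearMap.ker Abar).subtype) ⟨ρ ∘ v, hv⟩) =
      Fintype.linearCombination R g x +
        Fintype.linearCombination R (h₀ + ι ∘ fun i => f (Pi.single i 1)) v := by
    intro f v x hv hx
    rw [linearCombination_add_left, ← hf, ← add_assoc, ← hφ ⟨ρ ∘ v, hv⟩ v x rfl hx]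
    exact map_add ι _ _
  have hiff : ∀ f : (Fin n → κ) →ₗ[κ] W,
      Function.Surjective (Φ + f ∘ₗ (LinearMap.ker Abar).subtype) ↔
      ∀ y : G, π • y = 0 → ∃ v x, A v = π • x ∧ Fintype.linearCombination R g x +
        Fintype.linearCombination R (h₀ + ι ∘ fun i => f (Pi.single i 1)) v = y := by
    intro f
    constructor
    · intro h y hy
      obtain ⟨w, rfl⟩ := (hrange y).1 hy
      obtain ⟨⟨u, hu⟩, rfl⟩ := h w
      obtain ⟨v, x, rfl, hx⟩ := hlift ⟨u, hu⟩
      exact ⟨v, x, hx, (hΦ f v x hu hx).symm⟩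
    · intro h w
      obtain ⟨v, x, hx, hw⟩ := h (ι w) ((hrange _).2 ⟨w, rfl⟩)
      have hv : ρ ∘ v ∈ LinearMap.ker Abar := by
        rw [LinearMap.mem_ker, hA, hx, comp_smul_eq_zero hπ]
      exact ⟨⟨ρ ∘ v, hv⟩, hinj ((hΦ f v x hv hx).trans hw)⟩
  -- The solutions of c + πh = 0 form the coset h₀ + G[π]ⁿ, and G[π]ⁿ is Hom(κⁿ, W) through the
  -- values on the standard basis.
  refine congrArg (· * _) (Nat.card_congr (Equiv.symm (Equiv.ofBijective (fun f =>
    ⟨h₀ + ι ∘ fun i => f.1 (Pi.single i 1), ?_, (hiff f.1).1 f.2⟩) ⟨?_, ?_⟩)))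
  · have : π • (ι ∘ fun i => f.1 (Pi.single i 1)) = 0 := funext fun i => (hrange _).2 ⟨_, rfl⟩
    rw [smul_add, this, add_zero, hh₀]
  · intro f₁ f₂ h
    have h' := add_left_cancel (congrArg Subtype.val h)
    exact Subtype.ext (LinearMap.pi_ext' fun i => LinearMap.ext_ring (hinj (congrFun h' i)))
  · rintro ⟨h, hch, hsurj⟩
    have hdiff : π • (h - h₀) = 0 := by
      rw [smul_sub, sub_eq_zero]
      exact add_left_cancel (hch.trans hh₀.symm)
    choose w hw using fun i => (hrange ((h - h₀) i)).1 (congrFun hdiff i)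
    have e : (h₀ + ι ∘ fun i => Fintype.linearCombination κ w (Pi.single i 1)) = h := by
      funext i
      simp [hw]
    refine ⟨⟨Fintype.linearCombination κ w, (hiff _).2 ?_⟩, Subtype.ext e⟩
    rw [e]
    exact hsurj

end ModuleReduction

/-! ### Haar measure of residue classes in Mat_n(ℤ_p) -/

section PadicMeasure

open scoped Pointwise

variable {p : ℕ} [Fact p.Prime] {n : ℕ}

theorem PadicInt.dvd_of_norm_le {a b : ℤ_[p]} (hb : b ≠ 0) (h : ‖a‖ ≤ ‖b‖) : b ∣ a := by
  have hb' : (b : ℚ_[p]) ≠ 0 := fun h0 => hb (Subtype.ext h0)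
  refine ⟨⟨(a : ℚ_[p]) / b, ?_⟩, Subtype.ext (mul_div_cancel₀ _ hb').symm⟩
  rw [norm_div]
  exact div_le_one_of_le₀ h (norm_nonneg _)

/-- No continuity is assumed: |B| kills B, so the kernel contains all multiples of |B|, in
particular all matrices with small enough entries. -/
theorem PadicInt.isOpen_ker_of_finite {B : Type*} [AddCommGroup B] [Finite B]
    (f : Matrix (Fin n) (Fin n) ℤ_[p] →+ B) :
    IsOpen (f.ker : Set (Matrix (Fin n) (Fin n) ℤ_[p])) := by
  set m : ℤ_[p] := (Nat.card B : ℤ_[p])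
  have hm : m ≠ 0 := Nat.cast_ne_zero.2 Nat.card_pos.ne'
  have hU : IsOpen {E : Matrix (Fin n) (Fin n) ℤ_[p] | ∀ i j, ‖E i j‖ < ‖m‖} := by
    simp only [Set.ofPred_forall]
    refine isOpen_iInter_of_finite fun i => isOpen_iInter_of_finite fun j => ?_
    exact isOpen_lt (by fun_prop) continuous_const
  refine AddSubgroup.isOpen_of_mem_nhds (g := 0) _ (Filter.mem_of_superset
    (hU.mem_nhds fun i j => by simpa using hm) ?_)
  intro E hE
  have hd : ∀ i j, ∃ e, E i j = m * e := fun i j => PadicInt.dvd_of_norm_le hm (hE i j).le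
  choose e he using hd
  have : E = Nat.card B • (Matrix.of e) := by
    ext i j
    simp [he, m]
  rw [SetLike.mem_coe, AddMonoidHom.mem_ker, this, map_nsmul]
  exact card_nsmul_eq_zero'

theorem PadicInt.toZMod_eq_zero_iff_dvd (a : ℤ_[p]) : PadicInt.toZMod a = 0 ↔ (p : ℤ_[p]) ∣ a := by
  rw [← RingHom.mem_ker, PadicInt.ker_toZMod, PadicInt.maximalIdeal_eq_span_p,
    Ideal.mem_span_singleton]

theorem map_toZMod_eq_iff (X X₁ : Matrix (Fin n) (Fin n) ℤ_[p]) :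
    X.map PadicInt.toZMod = X₁.map PadicInt.toZMod ↔ ∃ E, X = X₁ + p • E := by
  constructor
  · intro h
    have hd : ∀ i j, ∃ e, X i j - X₁ i j = (p : ℤ_[p]) * e := fun i j => by
      refine (PadicInt.toZMod_eq_zero_iff_dvd _).1 ?_
      rw [map_sub, sub_eq_zero]
      exact congrFun (congrFun h i) j
    choose e he using hd
    refine ⟨Matrix.of e, ?_⟩
    ext i j
    have := he i j
    simp [← this]
  · rintro ⟨E, rfl⟩
    ext i j
    simp only [Matrix.map_apply, Matrix.add_apply, Matrix.smul_apply, map_add, map_nsmul]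
    simp

/-- Multiplication by `p` on `Mat_n(ℤ_p)`. -/
def matNsmul (p : ℕ) [Fact p.Prime] (n : ℕ) :
    Matrix (Fin n) (Fin n) ℤ_[p] →+ Matrix (Fin n) (Fin n) ℤ_[p] := nsmulAddMonoidHom p

theorem matNsmul_apply (E : Matrix (Fin n) (Fin n) ℤ_[p]) : matNsmul p n E = p • E := rfl

theorem matNsmul_injective : Function.Injective (matNsmul p n) := by
  intro E F h
  ext i j
  have := congrFun (congrFun h i) j
  have hp : (p : ℤ_[p]) ≠ 0 := Nat.cast_ne_zero.2 (Fact.out : p.Prime).ne_zero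
  simpa [matNsmul_apply, hp] using this

theorem index_range_matNsmul : (matNsmul p n).range.index = p ^ n ^ 2 := by
  let f : Matrix (Fin n) (Fin n) ℤ_[p] →+ Matrix (Fin n) (Fin n) (ZMod p) :=
    AddMonoidHom.mapMatrix (PadicInt.toZMod (p := p)).toAddMonoidHom
  have hf : Function.Surjective f := by
    intro Y
    choose e he using fun i j => ZMod.ringHom_surjective (PadicInt.toZMod (p := p)) (Y i j)
    exact ⟨Matrix.of e, by ext i j; exact he i j⟩
  have hk : (matNsmul p n).range = f.ker := by
    ext X
    rw [AddMonoidHom.mem_ker]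
    have := map_toZMod_eq_iff X 0
    rw [Matrix.map_zero _ (map_zero _)] at this
    refine Iff.trans ?_ this.symm
    simp [AddMonoidHom.mem_range, matNsmul_apply, eq_comm]
  rw [hk, AddSubgroup.index_ker, AddMonoidHom.range_eq_top.2 hf,
    Nat.card_congr AddSubgroup.topEquiv.toEquiv]
  have : Nat.card (Matrix (Fin n) (Fin n) (ZMod p)) = Nat.card (Fin n → Fin n → ZMod p) := rfl
  rw [this, Nat.card_fun, Nat.card_fun, Nat.card_fin, Nat.card_zmod, ← pow_mul, sq]

/-- The Haar measure of the residue class of `X₁` modulo `p`, with a condition on the next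
`p`-adic digits. -/
theorem matHaar_real_add_smul {B : Type*} [AddCommGroup B] [Finite B]
    (f : Matrix (Fin n) (Fin n) ℤ_[p] →+ B) (hf : Function.Surjective f)
    (X₁ : Matrix (Fin n) (Fin n) ℤ_[p]) (H : Set B) :
    MeasurableSet {X | ∃ E, X = X₁ + p • E ∧ f E ∈ H} ∧
    (matHaar p n).real {X | ∃ E, X = X₁ + p • E ∧ f E ∈ H} =
      Nat.card H / ((p : ℝ) ^ n ^ 2 * Nat.card B) := by
  -- K = p · ker f. Each condition f E = b cuts out a translate of K, of measure 1/[Mat_n(ℤ_p) : K].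
  set K := f.ker.map (matNsmul p n)
  have hKindex : K.index = p ^ n ^ 2 * Nat.card B := by
    rw [AddSubgroup.index_map_of_injective _ matNsmul_injective, index_range_matNsmul,
      AddSubgroup.index_ker, AddMonoidHom.range_eq_top.2 hf,
      Nat.card_congr AddSubgroup.topEquiv.toEquiv, mul_comm]
  have hp0 : p ≠ 0 := (Fact.out : p.Prime).ne_zero
  have hK0 : K.index ≠ 0 := by
    rw [hKindex]
    exact mul_ne_zero (pow_ne_zero _ hp0) Nat.card_pos.ne'
  have : K.FiniteIndex := ⟨hK0⟩
  have hKclosed : IsClosed (K : Set (Matrix (Fin n) (Fin n) ℤ_[p])) := by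
    have hc : IsClosed (f.ker : Set (Matrix (Fin n) (Fin n) ℤ_[p])) :=
      AddSubgroup.isClosed_of_isOpen _ (PadicInt.isOpen_ker_of_finite f)
    have hcont : Continuous (matNsmul p n) := by
      change Continuous fun E : Matrix (Fin n) (Fin n) ℤ_[p] => p • E
      fun_prop
    exact (hc.isCompact.image hcont).isClosed
  have hKmeas := hKclosed.measurableSet
  have hμK : (matHaar p n).real K = ((p : ℝ) ^ n ^ 2 * Nat.card B)⁻¹ := by
    have h := congrArg ENNReal.toReal (K.index_mul_measure hKmeas (matHaar p n))
    rw [measure_univ, ENNReal.toReal_mul, ENNReal.toReal_one, ENNReal.toReal_natCast, hKindex] at h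
    rw [Measure.real, eq_inv_of_mul_eq_one_right h]
    push_cast
    rfl
  have hfib : ∀ b, {X | ∃ E, X = X₁ + p • E ∧ f E = b} =
      (X₁ + p • Function.surjInv hf b) +ᵥ (K : Set (Matrix (Fin n) (Fin n) ℤ_[p])) := by
    intro b
    ext X
    rw [Set.mem_vadd_set]
    constructor
    · rintro ⟨E, rfl, rfl⟩
      refine ⟨p • (E - Function.surjInv hf (f E)), ⟨_, ?_, rfl⟩, ?_⟩
      · rw [SetLike.mem_coe, AddMonoidHom.mem_ker, map_sub, Function.surjInv_eq hf, sub_self]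
      · rw [vadd_eq_add, smul_sub]
        abel
    · rintro ⟨_, ⟨E, hE, rfl⟩, rfl⟩
      refine ⟨Function.surjInv hf b + E, ?_, ?_⟩
      · rw [vadd_eq_add, matNsmul_apply, smul_add, add_assoc]
      · rw [map_add, Function.surjInv_eq hf, (AddMonoidHom.mem_ker).1 hE, add_zero]
  have hfib_meas : ∀ b, MeasurableSet {X | ∃ E, X = X₁ + p • E ∧ f E = b} := fun b => by
    rw [hfib]
    exact (hKclosed.vadd _).measurableSet
  have hfib_real : ∀ b, (matHaar p n).real {X | ∃ E, X = X₁ + p • E ∧ f E = b} =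
      ((p : ℝ) ^ n ^ 2 * Nat.card B)⁻¹ := fun b => by
    rw [hfib, Measure.real, measure_vadd, ← Measure.real, hμK]
  have hunion : {X | ∃ E, X = X₁ + p • E ∧ f E ∈ H} =
      ⋃ b ∈ H.toFinite.toFinset, {X | ∃ E, X = X₁ + p • E ∧ f E = b} := by
    ext X
    simp only [Set.mem_ofPred_eq, Set.mem_iUnion, Set.Finite.mem_toFinset, exists_prop]
    constructor
    · rintro ⟨E, h, hE⟩
      exact ⟨_, hE, E, h, rfl⟩
    · rintro ⟨_, hb, E, h, rfl⟩
      exact ⟨E, h, hb⟩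
  rw [hunion]
  refine ⟨Finset.measurableSet_biUnion _ fun b _ => hfib_meas b, ?_⟩
  rw [measureReal_biUnion_finset _ fun b _ => hfib_meas b, Finset.sum_congr rfl
    fun b _ => hfib_real b, Finset.sum_const, nsmul_eq_mul, div_eq_mul_inv,
    ← Set.ncard_eq_toFinset_card, ← Nat.card_coe_set_eq]
  intro b _ b' _ hne
  refine Set.disjoint_left.2 ?_
  -- X determines E, as multiplication by p is injective; so distinct values b give disjoint sets.
  rintro X ⟨E, rfl, rfl⟩ ⟨E', h, rfl⟩
  exact hne (congrArg f (matNsmul_injective (add_left_cancel h)))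

end PadicMeasure

/-! ### The ring ℤ_p[t]/(P), and the modules G/pG and G[p] -/

section AdjoinRootReduction

variable {p : ℕ} [Fact p.Prime] {P : ℤ_[p][X]}

theorem redHom_eq_zero_iff (a : AdjoinRoot P) : redHom P a = 0 ↔ (p : AdjoinRoot P) ∣ a := by
  rw [← RingHom.mem_ker, ker_redHom, Ideal.mem_span_singleton]

theorem redHom_of (a : ℤ_[p]) :
    redHom P (AdjoinRoot.of P a) = AdjoinRoot.of (redPoly P) (PadicInt.toZMod a) := by
  rw [← AdjoinRoot.mk_C, ← AdjoinRoot.mk_C, redHom_mk]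
  exact congrArg _ (Polynomial.map_C _)

theorem redHom_root : redHom P (AdjoinRoot.root P) = AdjoinRoot.root (redPoly P) := by
  rw [← AdjoinRoot.mk_X, ← AdjoinRoot.mk_X, redHom_mk]
  exact congrArg _ (Polynomial.map_X _)

/-- For monic P the ring is free over the domain ℤ_p, hence torsion-free. -/
theorem natCast_p_mul_eq_zero (hP : P.Monic) (a : AdjoinRoot P) (h : (p : AdjoinRoot P) * a = 0) :
    a = 0 := by
  have := hP.free_adjoinRoot
  have hp : (p : ℤ_[p]) ≠ 0 := Nat.cast_ne_zero.2 (Fact.out : p.Prime).ne_zero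
  refine (smul_eq_zero_iff_right hp).1 ?_
  rw [Algebra.smul_def, map_natCast, h]

/-- The ring is integral over ℤ_p, so each of its maximal ideals lies over the unique maximal ideal
(p). -/
theorem natCast_p_mem_jacobson (hP : P.Monic) :
    (p : AdjoinRoot P) ∈ Ideal.jacobson (⊥ : Ideal (AdjoinRoot P)) := by
  have := hP.finite_adjoinRoot
  rw [Ideal.jacobson, Submodule.mem_sInf]
  rintro m ⟨-, hm⟩
  have hc := Ideal.isMaximal_comap_of_isIntegral_of_isMaximal (R := ℤ_[p]) m
  have hp : (p : ℤ_[p]) ∈ Ideal.comap (algebraMap ℤ_[p] (AdjoinRoot P)) m := by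
    rw [IsLocalRing.eq_maximalIdeal hc, PadicInt.maximalIdeal_eq_span_p]
    exact Ideal.mem_span_singleton_self _
  rwa [Ideal.mem_comap, map_natCast] at hp

theorem natCard_adjoinRoot_redPoly (hP : P.Monic) :
    Nat.card (AdjoinRoot (redPoly P)) = p ^ P.natDegree := by
  have hne : redPoly P ≠ 0 := (hP.map _).ne_zero
  have := (hP.map (PadicInt.toZMod (p := p))).finite_adjoinRoot
  rw [Module.natCard_eq_pow_finrank (K := ZMod p), (AdjoinRoot.powerBasis hne).finrank,
    AdjoinRoot.powerBasis_dim, Nat.card_zmod, redPoly, hP.natDegree_map]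

theorem redHom_comp_subRoot {n : ℕ} (X : Matrix (Fin n) (Fin n) ℤ_[p])
    (v : Fin n → AdjoinRoot P) :
    subRoot (redPoly P) (X.map PadicInt.toZMod) (redHom P ∘ v) = redHom P ∘ subRoot P X v := by
  funext i
  simp [subRoot_apply, Matrix.mulVec, dotProduct, redHom_of, redHom_root]

variable {G : Type*} [AddCommGroup G] [Module (AdjoinRoot P) G]

theorem RedMod.mk_surjective : Function.Surjective (RedMod.mk P G) :=
  Submodule.mkQ_surjective _

theorem RedMod.mk_eq_zero_iff (x : G) :
    RedMod.mk P G x = 0 ↔ ∃ y, x = (p : AdjoinRoot P) • y := by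
  refine (Submodule.Quotient.mk_eq_zero _).trans ?_
  rw [Submodule.ideal_span_singleton_smul, Submodule.mem_smul_pointwise_iff_exists]
  simp [eq_comm]

/-- The `p`-torsion of a module over `ℤ_p[t]/(P(t))`. -/
def PTorsion (P : ℤ_[p][X]) (G : Type*) [AddCommGroup G] [Module (AdjoinRoot P) G] : Type _ :=
  Submodule.torsionBySet (AdjoinRoot P) G (Ideal.span {(p : AdjoinRoot P)} : Set (AdjoinRoot P))

instance PTorsion.instAddCommGroup : AddCommGroup (PTorsion P G) :=
  inferInstanceAs (AddCommGroup (Submodule.torsionBySet (AdjoinRoot P) G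
    (Ideal.span {(p : AdjoinRoot P)} : Set (AdjoinRoot P))))

instance PTorsion.instModuleQuot :
    Module (AdjoinRoot P ⧸ Ideal.span {(p : AdjoinRoot P)}) (PTorsion P G) :=
  inferInstanceAs (Module (AdjoinRoot P ⧸ Ideal.span {(p : AdjoinRoot P)})
    (Submodule.torsionBySet (AdjoinRoot P) G
      (Ideal.span {(p : AdjoinRoot P)} : Set (AdjoinRoot P))))

/-- The `p`-torsion of `G` as a module over `𝔽_p[t]/(P(t))`. -/
instance PTorsion.instModule : Module (AdjoinRoot (redPoly P)) (PTorsion P G) :=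
  Module.compHom (PTorsion P G) (redEquiv P).symm.toRingHom

/-- The inclusion `G[p] → G`. -/
def PTorsion.incl : PTorsion P G →+ G :=
  (Submodule.subtype (Submodule.torsionBySet (AdjoinRoot P) G
    (Ideal.span {(p : AdjoinRoot P)} : Set (AdjoinRoot P)))).toAddMonoidHom

theorem PTorsion.incl_injective : Function.Injective (PTorsion.incl (P := P) (G := G)) :=
  Subtype.val_injective

theorem PTorsion.incl_redHom_smul (a : AdjoinRoot P) (w : PTorsion P G) :
    PTorsion.incl (redHom P a • w) = a • PTorsion.incl w := by
  have h : (redEquiv P).symm (redHom P a) = Ideal.Quotient.mk _ a := by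
    rw [RingEquiv.symm_apply_eq]; rfl
  change PTorsion.incl ((redEquiv P).symm (redHom P a) • w) = _
  rw [h]; rfl

theorem PTorsion.smul_eq_zero_iff (x : G) :
    (p : AdjoinRoot P) • x = 0 ↔ ∃ w : PTorsion P G, PTorsion.incl w = x := by
  constructor
  · intro h
    refine ⟨⟨x, ?_⟩, rfl⟩
    rw [Submodule.torsionBySet_span_singleton_eq]
    exact h
  · rintro ⟨⟨x, hx⟩, rfl⟩
    rw [Submodule.torsionBySet_span_singleton_eq] at hx
    exact hx

/-- `G[p]` and `G/pG` have the same size. -/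
theorem PTorsion.natCard_eq [Finite G] : Nat.card (PTorsion P G) = Nat.card (RedMod P G) := by
  -- G[p] and G/pG are the kernel and cokernel of multiplication by p on a finite group; both have
  -- order |G|/|pG|.
  let f : G →+ G := DistribSMul.toAddMonoidHom G (p : AdjoinRoot P)
  have h1 : Nat.card (PTorsion P G) = Nat.card f.ker := by
    refine Nat.card_congr (Equiv.ofBijective (fun w => ⟨PTorsion.incl w, ?_⟩) ⟨?_, ?_⟩)
    · exact (PTorsion.smul_eq_zero_iff _).2 ⟨w, rfl⟩
    · intro w w' h
      exact PTorsion.incl_injective (Subtype.mk.inj h)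
    · rintro ⟨x, hx⟩
      obtain ⟨w, rfl⟩ := (PTorsion.smul_eq_zero_iff x).1 hx
      exact ⟨w, rfl⟩
  have hk : (RedMod.mk P G).ker = f.range := by
    ext x
    rw [AddMonoidHom.mem_ker, RedMod.mk_eq_zero_iff, AddMonoidHom.mem_range]
    simp [f, eq_comm]
  have h2 : Nat.card (RedMod P G) = f.range.index := by
    rw [← hk, AddSubgroup.index_ker, AddMonoidHom.range_eq_top.2 RedMod.mk_surjective,
      Nat.card_congr AddSubgroup.topEquiv.toEquiv]
  have h3 := f.range.index_mul_card
  have h4 := f.ker.index_mul_card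
  rw [AddSubgroup.index_ker, mul_comm, ← h3] at h4
  rw [h1, h2]
  exact Nat.eq_of_mul_eq_mul_right Nat.card_pos h4

end AdjoinRootReduction

/-! ### Generation of G over ℤ_p -/

section Generators

variable {p : ℕ} [Fact p.Prime] {P : ℤ_[p][X]} {n : ℕ}
  {G : Type*} [AddCommGroup G] [Module (AdjoinRoot P) G]

/-- The homomorphism `E ↦ g E` from `Mat_n(ℤ_p)` to row vectors with entries in `G`. -/
def vecMulHom (P : ℤ_[p][X]) [Module (AdjoinRoot P) G] (g : Fin n → G) :
    Matrix (Fin n) (Fin n) ℤ_[p] →+ (Fin n → G) where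
  toFun E j := Fintype.linearCombination (AdjoinRoot P) g (fun i => AdjoinRoot.of P (E i j))
  map_zero' := by funext j; simp [Fintype.linearCombination_apply]
  map_add' E F := by
    funext j
    simp [Fintype.linearCombination_apply, add_smul, Finset.sum_add_distrib]

theorem linearCombination_mulVec (g : Fin n → G) (E : Matrix (Fin n) (Fin n) ℤ_[p])
    (v : Fin n → AdjoinRoot P) :
    Fintype.linearCombination (AdjoinRoot P) g ((E.map (AdjoinRoot.of P)).mulVec v) =
      Fintype.linearCombination (AdjoinRoot P) (vecMulHom P g E) v := by
  simp only [Fintype.linearCombination_apply, vecMulHom, AddMonoidHom.coe_mk, ZeroHom.coe_mk,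
    Matrix.mulVec, dotProduct, Matrix.map_apply, Finset.sum_smul, Finset.smul_sum, smul_smul]
  rw [Finset.sum_comm]
  simp only [mul_comm]

theorem linearCombination_subRoot (g : Fin n → G) (X : Matrix (Fin n) (Fin n) ℤ_[p])
    (v : Fin n → AdjoinRoot P) :
    Fintype.linearCombination (AdjoinRoot P) g (subRoot P X v) =
      Fintype.linearCombination (AdjoinRoot P) (vecMulHom P g X - AdjoinRoot.root P • g) v := by
  rw [subRoot_apply, map_sub, linearCombination_mulVec, map_smul, ← linearCombination_smul_left,
    sub_eq_iff_eq_add, ← linearCombination_add_left, sub_add_cancel]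

theorem subRoot_add_smul (X E : Matrix (Fin n) (Fin n) ℤ_[p]) (v : Fin n → AdjoinRoot P) :
    subRoot P (X + p • E) v =
      subRoot P X v + (p : AdjoinRoot P) • (E.map (AdjoinRoot.of P)).mulVec v := by
  have h : (X + p • E).map (AdjoinRoot.of P) =
      X.map (AdjoinRoot.of P) + (p : AdjoinRoot P) • E.map (AdjoinRoot.of P) := by
    ext i j
    simp only [Matrix.map_apply, Matrix.add_apply, Matrix.smul_apply, map_add, map_nsmul,
      smul_eq_mul]
    rw [nsmul_eq_mul]
  rw [subRoot_apply, subRoot_apply, h, Matrix.add_mulVec, Matrix.smul_mulVec]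
  abel

/-- Modulo X - t, powers of t can be traded for powers of X, so every class has a representative
with entries in ℤ_p. -/
theorem exists_of_add_subRoot (X : Matrix (Fin n) (Fin n) ℤ_[p]) (v : Fin n → AdjoinRoot P) :
    ∃ (x : Fin n → ℤ_[p]) (w : Fin n → AdjoinRoot P),
      v = (fun i => AdjoinRoot.of P (x i)) + subRoot P X w := by
  obtain ⟨c, hc⟩ := (PolyCok.equivQuotSubRoot P X).surjective
    ((LinearMap.range (subRoot P X)).mkQ v)
  obtain ⟨x, rfl⟩ := PolyCok.mk_surjective P X c
  have h : (LinearMap.range (subRoot P X)).mkQ (fun i => AdjoinRoot.of P (x i)) =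
      (LinearMap.range (subRoot P X)).mkQ v := hc
  rw [eq_comm, ← sub_eq_zero, ← map_sub, ← LinearMap.mem_ker, Submodule.ker_mkQ] at h
  obtain ⟨w, hw⟩ := h
  exact ⟨x, w, by rw [hw]; abel⟩

/-- If `g` presents `G/pG` with relations `X - t`, then `g` generates `G` over `ℤ_p`. -/
theorem exists_linearCombination_of [Finite G] [Fact (Irreducible (redPoly P))]
    (X : Matrix (Fin n) (Fin n) ℤ_[p]) {g : Fin n → G}
    (hsurj : Function.Surjective
      (Fintype.linearCombination (AdjoinRoot (redPoly P)) (RedMod.mk P G ∘ g)))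
    (hker : LinearMap.ker (Fintype.linearCombination (AdjoinRoot (redPoly P)) (RedMod.mk P G ∘ g))
      = LinearMap.range (subRoot (redPoly P) (X.map PadicInt.toZMod))) (b : G) :
    ∃ x : Fin n → ℤ_[p],
      Fintype.linearCombination (AdjoinRoot P) g (fun i => AdjoinRoot.of P (x i)) = b := by
  let : Module ℤ_[p] G := Module.compHom G (AdjoinRoot.of P)
  have hsmul : ∀ (a : ℤ_[p]) (x : G), a • x = AdjoinRoot.of P a • x := fun _ _ => rfl
  have hlc : ∀ x : Fin n → ℤ_[p], Fintype.linearCombination (AdjoinRoot P) g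
      (fun i => AdjoinRoot.of P (x i)) = Fintype.linearCombination ℤ_[p] g x := fun _ => rfl
  have hp : ∀ x : G, (p : AdjoinRoot P) • x = (p : ℤ_[p]) • x := fun x => by
    rw [hsmul, map_natCast]
  simp only [hlc]
  suffices h : (⊤ : Submodule ℤ_[p] G) ≤ LinearMap.range (Fintype.linearCombination ℤ_[p] g) from
    h Submodule.mem_top
  -- Nakayama over ℤ_p: it is enough to generate G modulo pG.
  refine Submodule.le_of_le_smul_of_le_jacobson_bot (I := IsLocalRing.maximalIdeal ℤ_[p])
    Module.Finite.fg_top (IsLocalRing.jacobson_eq_maximalIdeal _ bot_ne_top).ge ?_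
  have hmem : ∀ y : G, (p : ℤ_[p]) • y ∈
      IsLocalRing.maximalIdeal ℤ_[p] • (⊤ : Submodule ℤ_[p] G) := fun y =>
    Submodule.smul_mem_smul (by
      rw [PadicInt.maximalIdeal_eq_span_p]
      exact Ideal.mem_span_singleton_self _) Submodule.mem_top
  intro c _
  obtain ⟨u, hu⟩ := hsurj (RedMod.mk P G c)
  obtain ⟨v, rfl⟩ := (redHom_surjective P).comp_left u
  -- The part of v in (X - t)Rⁿ dies in G/pG, which leaves coefficients x in ℤ_p.
  obtain ⟨x, w, rfl⟩ := exists_of_add_subRoot X v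
  have h1 : RedMod.mk P G (Fintype.linearCombination (AdjoinRoot P) g (subRoot P X w)) = 0 := by
    rw [← linearCombination_comp_ringHom (RedMod.redHom_smul_mk P G · · |>.symm),
      ← redHom_comp_subRoot, ← LinearMap.mem_ker, hker]
    exact ⟨_, rfl⟩
  rw [linearCombination_comp_ringHom (RedMod.redHom_smul_mk P G · · |>.symm), map_add, map_add, h1,
    add_zero, eq_comm, ← sub_eq_zero, ← map_sub, RedMod.mk_eq_zero_iff] at hu
  obtain ⟨y, hy⟩ := hu
  rw [sub_eq_iff_eq_add, hp, hlc, add_comm] at hy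
  rw [hy]
  exact Submodule.add_mem_sup ⟨x, rfl⟩ (hmem y)

end Generators

/-! ### Presentations of G with relations X - t -/

section Presentation

variable {p : ℕ} [Fact p.Prime] {P : ℤ_[p][X]} {n : ℕ}
  {G : Type*} [AddCommGroup G] [Module (AdjoinRoot P) G]

/-- The tuple `g` generates `G`, with relation module `(X - t) Rⁿ`. -/
def IsPresentation (P : ℤ_[p][X]) [Module (AdjoinRoot P) G] (g : Fin n → G)
    (X : Matrix (Fin n) (Fin n) ℤ_[p]) : Prop :=
  Function.Surjective (Fintype.linearCombination (AdjoinRoot P) g) ∧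
    LinearMap.ker (Fintype.linearCombination (AdjoinRoot P) g) = LinearMap.range (subRoot P X)

/-- The tuple `g` generates `G/pG`, with relation module `(Y - t) κⁿ`. -/
def IsRedPresentation (P : ℤ_[p][X]) [Module (AdjoinRoot P) G] (g : Fin n → G)
    (Y : Matrix (Fin n) (Fin n) (ZMod p)) : Prop :=
  Function.Surjective (Fintype.linearCombination (AdjoinRoot (redPoly P)) (RedMod.mk P G ∘ g)) ∧
    LinearMap.ker (Fintype.linearCombination (AdjoinRoot (redPoly P)) (RedMod.mk P G ∘ g)) =
      LinearMap.range (subRoot (redPoly P) Y)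

theorem natCard_isPresentation (X : Matrix (Fin n) (Fin n) ℤ_[p])
    (h : Nonempty (PolyCok P X ≃ₗ[AdjoinRoot P] G)) :
    Nat.card {g : Fin n → G // IsPresentation P g X} = Nat.card (G ≃ₗ[AdjoinRoot P] G) := by
  obtain ⟨e⟩ := h
  exact (natCard_linearCombination _).trans
    (natCard_linearEquiv_eq ((PolyCok.equivQuotSubRoot P X).symm.trans e))

theorem IsPresentation.nonempty_equiv {g : Fin n → G} {X : Matrix (Fin n) (Fin n) ℤ_[p]}
    (h : IsPresentation P g X) : Nonempty (PolyCok P X ≃ₗ[AdjoinRoot P] G) :=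
  ⟨(PolyCok.equivQuotSubRoot P X).trans ((Submodule.quotEquivOfEq _ _ h.2.symm).trans
    (LinearMap.quotKerEquivOfSurjective _ h.1))⟩

variable [Fact (Irreducible (redPoly P))]

theorem IsPresentation.isRedPresentation {g : Fin n → G} {X : Matrix (Fin n) (Fin n) ℤ_[p]}
    (h : IsPresentation P g X) : IsRedPresentation P g (X.map PadicInt.toZMod) :=
  surjective_and_ker_reduction (redHom_surjective P) (RedMod.redHom_smul_mk P G · · |>.symm)
    RedMod.mk_surjective RedMod.mk_eq_zero_iff redHom_eq_zero_iff (redHom_comp_subRoot X) h.1 h.2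

variable [Finite G]

/-- The right-hand side involves E only through gE, so for fixed g the event is a condition on a
uniform element of Gⁿ. Its two clauses are the inclusion of (X - t)Rⁿ in the relations and, through
`ker_eq_range_iff`, the reverse inclusion. -/
theorem isPresentation_add_smul_iff (hP : P.Monic) {g : Fin n → G}
    {X₁ : Matrix (Fin n) (Fin n) ℤ_[p]}
    (hg : IsRedPresentation P g (X₁.map PadicInt.toZMod)) (E : Matrix (Fin n) (Fin n) ℤ_[p]) :
    IsPresentation P g (X₁ + p • E) ↔
      vecMulHom P g X₁ - AdjoinRoot.root P • g + (p : AdjoinRoot P) • vecMulHom P g E = 0 ∧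
      ∀ y : G, (p : AdjoinRoot P) • y = 0 → ∃ v x, subRoot P X₁ v = (p : AdjoinRoot P) • x ∧
        Fintype.linearCombination (AdjoinRoot P) g x +
          Fintype.linearCombination (AdjoinRoot P) (vecMulHom P g E) v = y := by
  have hsurj : Function.Surjective (Fintype.linearCombination (AdjoinRoot P) g) := fun b =>
    have ⟨_, hx⟩ := exists_linearCombination_of X₁ hg.1 hg.2 b
    ⟨_, hx⟩
  have hlc : ∀ v, Fintype.linearCombination (AdjoinRoot P) g (subRoot P (X₁ + p • E) v) =
      Fintype.linearCombination (AdjoinRoot P)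
        (vecMulHom P g X₁ - AdjoinRoot.root P • g + (p : AdjoinRoot P) • vecMulHom P g E) v := by
    intro v
    rw [subRoot_add_smul, map_add, map_smul, linearCombination_subRoot, linearCombination_mulVec,
      linearCombination_add_left, linearCombination_smul_left]
  have hzero : (∀ v, Fintype.linearCombination (AdjoinRoot P) g
      (subRoot P (X₁ + p • E) v) = 0) ↔
      vecMulHom P g X₁ - AdjoinRoot.root P • g + (p : AdjoinRoot P) • vecMulHom P g E = 0 := by
    constructor
    · intro h
      funext j
      have := h (Pi.single j 1)
      rwa [hlc, Fintype.linearCombination_apply_single, one_smul] at this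
    · intro h v
      rw [hlc, h]
      simp [Fintype.linearCombination_apply]
  have hred : (X₁ + p • E).map PadicInt.toZMod = X₁.map PadicInt.toZMod :=
    (map_toZMod_eq_iff _ _).2 ⟨E, rfl⟩
  have hcan := natCast_p_mul_eq_zero hP
  -- Passing from X₁ to X₁ + pE shifts the quotient of (X - t)v by p by E v, and g sends E v to
  -- (gE)v.
  have hconn : (∀ y : G, (p : AdjoinRoot P) • y = 0 → ∃ v x,
      subRoot P (X₁ + p • E) v = (p : AdjoinRoot P) • x ∧
        Fintype.linearCombination (AdjoinRoot P) g x = y) ↔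
      ∀ y : G, (p : AdjoinRoot P) • y = 0 → ∃ v x, subRoot P X₁ v = (p : AdjoinRoot P) • x ∧
        Fintype.linearCombination (AdjoinRoot P) g x +
          Fintype.linearCombination (AdjoinRoot P) (vecMulHom P g E) v = y := by
    refine forall₂_congr fun y _ => exists_congr fun v => ?_
    rw [subRoot_add_smul, ← linearCombination_mulVec]
    constructor
    · rintro ⟨x, hx, hy⟩
      refine ⟨x - (E.map (AdjoinRoot.of P)).mulVec v, ?_, ?_⟩
      · rw [smul_sub, ← hx, add_sub_cancel_right]
      · rw [map_sub, sub_add_cancel, hy]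
    · rintro ⟨x, hx, hy⟩
      exact ⟨x + (E.map (AdjoinRoot.of P)).mulVec v, by rw [hx, smul_add], by rw [map_add, hy]⟩
  have hmain := fun hle => ker_eq_range_iff (natCast_p_mem_jacobson hP) (redHom_surjective P)
    redHom_eq_zero_iff (RedMod.redHom_smul_mk P G · · |>.symm)
    (redHom_comp_subRoot (X₁ + p • E)) hsurj (hred ▸ hg.2) hle
  rw [← hzero, ← hconn]
  constructor
  · intro h
    have hle : ∀ v, Fintype.linearCombination (AdjoinRoot P) g (subRoot P (X₁ + p • E) v) = 0 :=
      fun v => by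
        rw [← LinearMap.mem_ker, h.2]
        exact ⟨v, rfl⟩
    exact ⟨hle, (hmain hle).1 h.2⟩
  · rintro ⟨hle, h⟩
    exact ⟨hsurj, (hmain hle).2 h⟩

variable {r : ℕ} {Y : Matrix (Fin n) (Fin n) (ZMod p)}

/-- The measure of the matrices in a residue class for which `g` is a presentation of `G`. -/
theorem matHaar_real_isPresentation (hP : P.Monic)
    (hG : Module.finrank (AdjoinRoot (redPoly P)) (RedMod P G) = r)
    (hY : Module.finrank (AdjoinRoot (redPoly P)) ((Fin n → AdjoinRoot (redPoly P)) ⧸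
      LinearMap.range (subRoot (redPoly P) Y)) = r)
    {g : Fin n → G} (hg : IsRedPresentation P g Y) :
    MeasurableSet {X : Matrix (Fin n) (Fin n) ℤ_[p] |
      X.map PadicInt.toZMod = Y ∧ IsPresentation P g X} ∧
    (matHaar p n).real {X : Matrix (Fin n) (Fin n) ℤ_[p] |
      X.map PadicInt.toZMod = Y ∧ IsPresentation P g X} *
        ((p : ℝ) ^ n ^ 2 * (Nat.card G : ℝ) ^ n) * ((p : ℝ) ^ P.natDegree) ^ r ^ 2 =
      ((∏ i : Fin r, ((p ^ P.natDegree) ^ r - (p ^ P.natDegree) ^ (i : ℕ)) : ℕ) : ℝ) *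
        (Nat.card (RedMod P G) : ℝ) ^ n := by
  obtain ⟨X₁, rfl⟩ : ∃ X₁ : Matrix (Fin n) (Fin n) ℤ_[p], X₁.map PadicInt.toZMod = Y := by
    choose e he using fun i j => ZMod.ringHom_surjective (PadicInt.toZMod (p := p)) (Y i j)
    exact ⟨Matrix.of e, by ext i j; exact he i j⟩
  have hκ := natCard_adjoinRoot_redPoly hP
  have hp0 : p ≠ 0 := (Fact.out : p.Prime).ne_zero
  have : Finite (AdjoinRoot (redPoly P)) :=
    Nat.finite_of_card_ne_zero (by rw [hκ]; exact pow_ne_zero _ hp0)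
  have : Finite (RedMod P G) := Finite.of_surjective _ RedMod.mk_surjective
  have : Finite (PTorsion P G) := Finite.of_injective _ PTorsion.incl_injective
  have hvec : Function.Surjective (vecMulHom P g) := by
    intro b
    choose x hx using fun j => exists_linearCombination_of X₁ hg.1 hg.2 (b j)
    exact ⟨Matrix.of fun i j => x j i, funext hx⟩
  have hW : Module.finrank (AdjoinRoot (redPoly P)) (PTorsion P G) = r := by
    have h := PTorsion.natCard_eq (P := P) (G := G)
    rw [Module.natCard_eq_pow_finrank (K := AdjoinRoot (redPoly P)),
      Module.natCard_eq_pow_finrank (K := AdjoinRoot (redPoly P)) (V := RedMod P G), hG] at h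
    exact Nat.pow_right_injective Finite.one_lt_card h
  -- The columns of X₁ - t are relations of g modulo p, so g(X₁ - t) is divisible by p in Gⁿ.
  have hh₀ : ∃ h₀ : Fin n → G,
      vecMulHom P g X₁ - AdjoinRoot.root P • g + (p : AdjoinRoot P) • h₀ = 0 := by
    have hd : ∀ j, ∃ y, (vecMulHom P g X₁ - AdjoinRoot.root P • g) j =
        (p : AdjoinRoot P) • y := by
      intro j
      rw [← RedMod.mk_eq_zero_iff, ← one_smul (AdjoinRoot P)
        ((vecMulHom P g X₁ - AdjoinRoot.root P • g) j), ← Fintype.linearCombination_apply_single,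
        ← linearCombination_subRoot,
        ← linearCombination_comp_ringHom (RedMod.redHom_smul_mk P G · · |>.symm),
        ← redHom_comp_subRoot, ← LinearMap.mem_ker, hg.2]
      exact ⟨_, rfl⟩
    choose y hy using hd
    exact ⟨-y, funext fun j => by simp [-Pi.sub_apply, hy j]⟩
  obtain ⟨h₀, hh₀⟩ := hh₀
  have hcount := natCard_perturbation (natCast_p_mul_eq_zero hP) (redHom_surjective P)
    redHom_eq_zero_iff PTorsion.incl_redHom_smul PTorsion.incl_injective
    PTorsion.smul_eq_zero_iff (redHom_comp_subRoot X₁) hW hY (linearCombination_subRoot g X₁) hh₀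
  have hmeas := matHaar_real_add_smul (vecMulHom P g) hvec X₁
    {h | vecMulHom P g X₁ - AdjoinRoot.root P • g + (p : AdjoinRoot P) • h = 0 ∧
      ∀ y : G, (p : AdjoinRoot P) • y = 0 → ∃ v x, subRoot P X₁ v = (p : AdjoinRoot P) • x ∧
        Fintype.linearCombination (AdjoinRoot P) g x +
          Fintype.linearCombination (AdjoinRoot P) h v = y}
  have hset : {X : Matrix (Fin n) (Fin n) ℤ_[p] |
      X.map PadicInt.toZMod = X₁.map PadicInt.toZMod ∧ IsPresentation P g X} =
      {X | ∃ E, X = X₁ + p • E ∧ vecMulHom P g E ∈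
        {h | vecMulHom P g X₁ - AdjoinRoot.root P • g + (p : AdjoinRoot P) • h = 0 ∧
        ∀ y : G, (p : AdjoinRoot P) • y = 0 → ∃ v x, subRoot P X₁ v = (p : AdjoinRoot P) • x ∧
          Fintype.linearCombination (AdjoinRoot P) g x +
            Fintype.linearCombination (AdjoinRoot P) h v = y}} := by
    ext X
    constructor
    · rintro ⟨h, hX⟩
      obtain ⟨E, rfl⟩ := (map_toZMod_eq_iff X X₁).1 h
      exact ⟨E, rfl, (isPresentation_add_smul_iff hP hg E).1 hX⟩
    · rintro ⟨E, rfl, hE⟩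
      exact ⟨(map_toZMod_eq_iff _ _).2 ⟨E, rfl⟩, (isPresentation_add_smul_iff hP hg E).2 hE⟩
  rw [hset]
  refine ⟨hmeas.1, ?_⟩
  rw [hmeas.2, ← PTorsion.natCard_eq, ← Nat.cast_pow (Nat.card (PTorsion P G)), ← Nat.cast_mul,
    ← hκ, ← hcount, hκ, Nat.card_fun, Nat.card_fin]
  have hp0' : (p : ℝ) ≠ 0 := Nat.cast_ne_zero.2 hp0
  have hG0 : (Nat.card G : ℝ) ≠ 0 := Nat.cast_ne_zero.2 Nat.card_pos.ne'
  push_cast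
  rw [div_mul_cancel₀ _ (by positivity)]
  rfl

end Presentation

/-! ### The order of GL_r, the double count and the final formula -/

theorem cast_prod_pow_sub_pow {q : ℕ} (hq : 1 < q) (r : ℕ) :
    ((∏ i : Fin r, (q ^ r - q ^ (i : ℕ)) : ℕ) : ℝ) =
      (q : ℝ) ^ r ^ 2 * ∏ i ∈ Finset.Icc 1 r, (1 - (q : ℝ) ^ (-(i : ℤ))) := by
  have hq0 : (q : ℝ) ≠ 0 := by positivity
  -- The natural-number subtractions do not truncate, so the cast commutes with them.
  have hle : ∀ i : Fin r, q ^ (i : ℕ) ≤ q ^ r := fun i =>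
    Nat.pow_le_pow_right (by positivity) i.2.le
  -- After the reflection i = r - 1 - j, the factor is q^r (1 - q^(-(j+1))).
  have hterm : ∀ j ∈ Finset.range r, (q : ℝ) ^ r - (q : ℝ) ^ (r - 1 - j) =
      (q : ℝ) ^ r * (1 - (q : ℝ) ^ (-((1 + j : ℕ) : ℤ))) := by
    intro j hj
    have hj' : (1 + j) + (r - 1 - j) = r := by
      have := Finset.mem_range.1 hj
      omega
    rw [mul_sub, mul_one, zpow_neg, zpow_natCast, sub_right_inj, eq_mul_inv_iff_mul_eq₀
      (pow_ne_zero _ hq0), ← pow_add, add_comm, hj']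
  rw [Nat.cast_prod, Finset.prod_congr rfl fun i _ => Nat.cast_sub (hle i)]
  simp only [Nat.cast_pow]
  rw [Fin.prod_univ_eq_prod_range (fun i => (q : ℝ) ^ r - (q : ℝ) ^ i) r,
    ← Finset.prod_range_reflect, Finset.prod_congr rfl hterm, Finset.prod_mul_distrib,
    Finset.prod_const, Finset.card_range, ← pow_mul, sq, ← Finset.Ico_succ_right_eq_Icc,
    Finset.prod_Ico_eq_prod_range]
  rfl

/-- Double counting: each matrix with cokernel `G` has `|Aut G|` presentations. -/
theorem sum_matHaar_real_isPresentation {p : ℕ} [Fact p.Prime] {P : ℤ_[p][X]} {n : ℕ}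
    {G : Type*} [AddCommGroup G] [Module (AdjoinRoot P) G] [Finite G] [Fintype (Fin n → G)]
    (Y : Matrix (Fin n) (Fin n) (ZMod p))
    (hmeas : ∀ g : Fin n → G, MeasurableSet {X : Matrix (Fin n) (Fin n) ℤ_[p] |
      X.map PadicInt.toZMod = Y ∧ IsPresentation P g X}) :
    MeasurableSet {X : Matrix (Fin n) (Fin n) ℤ_[p] |
        Nonempty (PolyCok P X ≃ₗ[AdjoinRoot P] G) ∧ X.map PadicInt.toZMod = Y} ∧
    ∑ g : Fin n → G, (matHaar p n).real {X : Matrix (Fin n) (Fin n) ℤ_[p] |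
      X.map PadicInt.toZMod = Y ∧ IsPresentation P g X} =
    (Nat.card (G ≃ₗ[AdjoinRoot P] G) : ℝ) * (matHaar p n).real
      {X : Matrix (Fin n) (Fin n) ℤ_[p] |
        Nonempty (PolyCok P X ≃ₗ[AdjoinRoot P] G) ∧ X.map PadicInt.toZMod = Y} := by
  classical
  have hcard : ∀ X : Matrix (Fin n) (Fin n) ℤ_[p],
      Nonempty (PolyCok P X ≃ₗ[AdjoinRoot P] G) →
      (Finset.univ.filter fun g : Fin n → G => IsPresentation P g X).card =
        Nat.card (G ≃ₗ[AdjoinRoot P] G) := fun X hX => by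
    rw [← natCard_isPresentation X hX, Nat.card_eq_fintype_card, Fintype.card_subtype]
  have hpos : 0 < Nat.card (G ≃ₗ[AdjoinRoot P] G) := by
    have : Finite (G ≃ₗ[AdjoinRoot P] G) := DFunLike.finite _
    exact Nat.card_pos
  have hevent : {X : Matrix (Fin n) (Fin n) ℤ_[p] |
      Nonempty (PolyCok P X ≃ₗ[AdjoinRoot P] G) ∧ X.map PadicInt.toZMod = Y} =
      ⋃ g : Fin n → G, {X : Matrix (Fin n) (Fin n) ℤ_[p] |
        X.map PadicInt.toZMod = Y ∧ IsPresentation P g X} := by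
    ext X
    rw [Set.mem_iUnion]
    constructor
    · rintro ⟨hX, hY⟩
      have : 0 < (Finset.univ.filter fun g : Fin n → G => IsPresentation P g X).card := by
        rw [hcard X hX]
        exact hpos
      obtain ⟨g, hg⟩ := Finset.card_pos.1 this
      exact ⟨g, hY, (Finset.mem_filter.1 hg).2⟩
    · rintro ⟨g, hY, hg⟩
      exact ⟨hg.nonempty_equiv, hY⟩
  have hev_meas : MeasurableSet {X : Matrix (Fin n) (Fin n) ℤ_[p] |
      Nonempty (PolyCok P X ≃ₗ[AdjoinRoot P] G) ∧ X.map PadicInt.toZMod = Y} := by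
    rw [hevent]
    exact MeasurableSet.iUnion hmeas
  refine ⟨hev_meas, ?_⟩
  -- With measures written as integrals of indicators, the identity becomes pointwise in X: the
  -- number of g presenting G with relations X - t is |Aut G| or 0.
  simp_rw [← integral_indicator_one (hmeas _)]
  rw [← integral_indicator_one hev_meas, ← integral_const_mul, ← integral_finsetSum]
  · refine integral_congr_ae (Filter.Eventually.of_forall fun X => ?_)
    simp only [Set.indicator_apply, Set.mem_ofPred_eq, Pi.one_apply]
    by_cases hY : X.map PadicInt.toZMod = Y
    · by_cases hX : Nonempty (PolyCok P X ≃ₗ[AdjoinRoot P] G)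
      · simp [hY, hX, hcard X hX]
      · have : ∀ g : Fin n → G, ¬ IsPresentation P g X := fun g hg => hX hg.nonempty_equiv
        simp [hX, this]
    · simp [hY]
  · exact fun g _ => (integrable_const (1 : ℝ)).indicator (hmeas g)

end

theorem theorem1p1 (p : ℕ) [Fact p.Prime] (P : ℤ_[p][X]) (hP : P.Monic)
    (hPirr : Irreducible (redPoly P))
    (G : Type*) [AddCommGroup G] [Module (AdjoinRoot P) G] [Finite G]
    (n : ℕ) (hn : 1 ≤ n) (Xbar : Matrix (Fin n) (Fin n) (ZMod p))
    (hXbar : Nonempty (PolyCok (redPoly P) Xbar ≃+ RedMod P G)) :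
    MeasurableSet {X : Matrix (Fin n) (Fin n) ℤ_[p] |
        Nonempty (PolyCok P X ≃ₗ[AdjoinRoot P] G) ∧ X.map PadicInt.toZMod = Xbar} ∧
    (matHaar p n).real {X : Matrix (Fin n) (Fin n) ℤ_[p] |
        Nonempty (PolyCok P X ≃ₗ[AdjoinRoot P] G) ∧ X.map PadicInt.toZMod = Xbar} =
      (p : ℝ) ^ ((P.natDegree : ℤ) * (resRank P G : ℤ) ^ 2 - (n : ℤ) ^ 2)
          / (Nat.card (G ≃ₗ[AdjoinRoot P] G) : ℝ)
        * ∏ i ∈ Finset.Icc 1 (resRank P G),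
            (1 - (p : ℝ) ^ (-((i : ℤ) * (P.natDegree : ℤ)))) ^ 2 := by
  have : Fact (Irreducible (redPoly P)) := ⟨hPirr⟩
  have := Fintype.ofFinite (Fin n → G)
  have hp1 : 1 < p := (Fact.out : p.Prime).one_lt
  have hp0 : (p : ℝ) ≠ 0 := by positivity
  have hκ := natCard_adjoinRoot_redPoly hP
  have : Finite (AdjoinRoot (redPoly P)) :=
    Nat.finite_of_card_ne_zero (by rw [hκ]; positivity)
  have : Finite (RedMod P G) := Finite.of_surjective _ RedMod.mk_surjective
  have hG : Module.finrank (AdjoinRoot (redPoly P)) (RedMod P G) = resRank P G := rfl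
  -- Only the order of the groups is used: over the finite field κ it determines the dimension, so
  -- an additive isomorphism suffices.
  have hY : Module.finrank (AdjoinRoot (redPoly P)) ((Fin n → AdjoinRoot (redPoly P)) ⧸
      LinearMap.range (subRoot (redPoly P) Xbar)) = resRank P G := by
    have h := (Nat.card_congr (PolyCok.equivQuotSubRoot (redPoly P) Xbar).toEquiv).symm.trans
      (Nat.card_congr hXbar.some.toEquiv)
    rw [Module.natCard_eq_pow_finrank (K := AdjoinRoot (redPoly P)),
      Module.natCard_eq_pow_finrank (K := AdjoinRoot (redPoly P)) (V := RedMod P G), hG] at h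
    exact Nat.pow_right_injective Finite.one_lt_card h
  have hgood := fun g hg => matHaar_real_isPresentation (n := n) (g := g) hP hG hY hg
  have hbad : ∀ g : Fin n → G, ¬ IsRedPresentation P g Xbar →
      {X : Matrix (Fin n) (Fin n) ℤ_[p] |
        X.map PadicInt.toZMod = Xbar ∧ IsPresentation P g X} = ∅ := by
    intro g hg
    refine Set.eq_empty_iff_forall_notMem.2 ?_
    rintro X ⟨rfl, hX⟩
    exact hg hX.isRedPresentation
  have hmeas : ∀ g : Fin n → G, MeasurableSet {X : Matrix (Fin n) (Fin n) ℤ_[p] |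
      X.map PadicInt.toZMod = Xbar ∧ IsPresentation P g X} := by
    intro g
    by_cases hg : IsRedPresentation P g Xbar
    · exact (hgood g hg).1
    · rw [hbad g hg]
      exact MeasurableSet.empty
  obtain ⟨hev, hsum⟩ := sum_matHaar_real_isPresentation (P := P) Xbar hmeas
  refine ⟨hev, ?_⟩
  have hcount := natCard_lift_presentation RedMod.mk_surjective
    (subRoot (redPoly P) Xbar) hG hY
  set r := resRank P G
  set d := P.natDegree
  set N : ℕ := ∏ i : Fin r, ((p ^ d) ^ r - (p ^ d) ^ (i : ℕ)) with hN
  set μ := (matHaar p n).real {X : Matrix (Fin n) (Fin n) ℤ_[p] |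
    Nonempty (PolyCok P X ≃ₗ[AdjoinRoot P] G) ∧ X.map PadicInt.toZMod = Xbar}
  rw [hκ, ← hN] at hcount
  have hGn : (Nat.card G : ℝ) ^ n ≠ 0 := pow_ne_zero _ (Nat.cast_ne_zero.2 Nat.card_pos.ne')
  have hDn : (Nat.card (RedMod P G) : ℝ) ^ n ≠ 0 :=
    pow_ne_zero _ (Nat.cast_ne_zero.2 Nat.card_pos.ne')
  have hAut : (Nat.card (G ≃ₗ[AdjoinRoot P] G) : ℝ) ≠ 0 := by
    have : Finite (G ≃ₗ[AdjoinRoot P] G) := DFunLike.finite _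
    exact Nat.cast_ne_zero.2 Nat.card_pos.ne'
  -- One factor N counts the admissible g, the other the surjective connecting maps; |G|ⁿ and
  -- |G/pG|ⁿ cancel between the two counts.
  have htotal : (Nat.card (G ≃ₗ[AdjoinRoot P] G) : ℝ) * μ *
      ((p : ℝ) ^ n ^ 2 * ((p : ℝ) ^ d) ^ r ^ 2) = (N : ℝ) ^ 2 := by
    classical
    rw [← mul_left_inj' hGn, ← mul_left_inj' hDn, ← hsum]
    have hterm : ∀ g : Fin n → G, (matHaar p n).real {X : Matrix (Fin n) (Fin n) ℤ_[p] |
        X.map PadicInt.toZMod = Xbar ∧ IsPresentation P g X} *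
        ((p : ℝ) ^ n ^ 2 * (Nat.card G : ℝ) ^ n) * ((p : ℝ) ^ d) ^ r ^ 2 =
        if IsRedPresentation P g Xbar then (N : ℝ) * (Nat.card (RedMod P G) : ℝ) ^ n else 0 := by
      intro g
      split_ifs with hg
      · exact (hgood g hg).2
      · rw [hbad g hg, measureReal_empty, zero_mul, zero_mul]
    have h := Finset.sum_congr rfl fun g (_ : g ∈ Finset.univ) => hterm g
    rw [← Finset.sum_mul, ← Finset.sum_mul, ← Finset.sum_filter, Finset.sum_const,
      nsmul_eq_mul] at h
    have hc : (Nat.card {g : Fin n → G // IsRedPresentation P g Xbar} : ℝ) *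
        (Nat.card (RedMod P G) : ℝ) ^ n = N * (Nat.card G : ℝ) ^ n := by
      exact_mod_cast hcount
    rw [Nat.card_eq_fintype_card, Fintype.card_subtype] at hc
    linear_combination (Nat.card (RedMod P G) : ℝ) ^ n * h +
      (N : ℝ) * (Nat.card (RedMod P G) : ℝ) ^ n * hc
  have hd : d ≠ 0 := by
    have := hPirr.natDegree_pos
    rw [redPoly, hP.natDegree_map] at this
    exact this.ne'
  have hprod := cast_prod_pow_sub_pow (one_lt_pow₀ hp1 hd) r
  rw [← hN, Nat.cast_pow] at hprod
  have hfac : ∀ i : ℕ, ((p : ℝ) ^ d) ^ (-(i : ℤ)) = (p : ℝ) ^ (-((i : ℤ) * (d : ℤ))) := by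
    intro i
    rw [← zpow_natCast, ← zpow_mul]
    congr 1
    ring
  simp only [hfac] at hprod
  have hexp : (p : ℝ) ^ ((d : ℤ) * (r : ℤ) ^ 2 - (n : ℤ) ^ 2) =
      ((p : ℝ) ^ d) ^ r ^ 2 / (p : ℝ) ^ n ^ 2 := by
    rw [zpow_sub₀ hp0, ← pow_mul, ← zpow_natCast, ← zpow_natCast]
    push_cast
    rfl
  have hq0 : ((p : ℝ) ^ d) ^ r ^ 2 ≠ 0 := by positivity
  rw [hprod, mul_pow] at htotal
  rw [hexp, Finset.prod_pow]
  field_simp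
  refine mul_right_cancel₀ hq0 ?_
  linear_combination htotal
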